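/- Let $n\ge 2$ and let $\mathbb H^n$ be the hyperbolic space in the half-space model $\Pi^{n,+}=\{x\in\mathbb R^n : x_n>0\}$ with metric $x_n^{-2}\langle\cdot,\cdot\rangle$. A \emph{horosphere} is a hyperplane $\{x_n=a\}$, $a>0$, or a Euclidean sphere tangent to $\{x_n=0\}$ from above, without the point of tangency; a \emph{generalized hypersphere} is a horosphere or the part in $\Pi^{n,+}$ of a Euclidean sphere or hyperplane that intersects $\{x_n=0\}$ transversely. A \emph{horocycle} is an arc-length parametrized complete geodesic line $\gamma:\mathbb R\to\mathbb H^n$ of a horosphere. A function $h:\mathbb R\to\mathbb R$ is an \emph{umbilical route} along $\gamma$ if there are generalized hyperspheres $L_t$ $(t\in\mathbb R)$, where $L_t$ passes through $\gamma(t)$, is orthogonal to $\gamma$ there, and has mean curvature $h(t)$ at $\gamma(t)$ with respect to the orientation opposite to $\gamma$, such that all the $L_t$ are leaves of a (transversely $C^0$, codimension one) totally umbilical foliation of $\mathbb H^n$ with smooth leaves. Let $\gamma$ be a horocycle in $\mathbb H^n$. Then: 1. A function $h:\mathbb R\to\mathbb R$ is an umbilical route along $\gamma$ if and only if $h\equiv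 0$. 2. Every generalized hypersphere that meets $\gamma$ in exactly one point, and orthogonally there, is totally geodesic. If $\gamma$ is a Euclidean line parallel to $\{x_n=0\}$, every such generalized hypersphere is the part in $\Pi^{n,+}$ of a vertical hyperplane (a hyperplane orthogonal to $\{x_n=0\}$). In general there is an isometry of $\mathbb H^n$ that maps $\gamma$ onto a line parallel to $\{x_n=0\}$ and maps every such generalized hypersphere onto the part in $\Pi^{n,+}$ of a vertical hyperplane. -/

import Mathlib

open scoped ContDiff

noncomputable section

namespace HypUmb

/-! ### The half-space model of hyperbolic space of dimension `m + 1` -/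

/-- The ambient Euclidean space of dimension `m + 1`. -/
abbrev E (m : ℕ) : Type := EuclideanSpace ℝ (Fin (m + 1))

/-- The last coordinate. -/
def height {m : ℕ} (x : E m) : ℝ := x (Fin.last m)

/-- The last vector of the standard basis. -/
def eLast (m : ℕ) : E m := EuclideanSpace.single (Fin.last m) 1

/-- The open upper half-space, the underlying set of the model. -/
def halfSpace (m : ℕ) : Set (E m) := {x | 0 < height x}

/-- The hyperbolic metric tensor at `x`: the Euclidean one divided by the square of the height. -/
def hypMetric {m : ℕ} (x u v : E m) : ℝ := inner ℝ u v / height x ^ 2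

/-- The Christoffel tensor of the Levi-Civita connection of `hypMetric`. -/
def christoffel {m : ℕ} (x u v : E m) : E m :=
  (-(height x)⁻¹) • (height u • v + height v • u - (inner ℝ u v : ℝ) • eLast m)

/-- The connection is torsion-free. -/
theorem christoffel_symm {m : ℕ} (x u v : E m) : christoffel x u v = christoffel x v u := by
  unfold christoffel
  rw [real_inner_comm, add_comm (height u • v)]

/-- The connection is compatible with the metric; the derivative of `g(u, v)` in direction `w`, for
constant fields `u` and `v`, is `g(∇_w u, v) + g(u, ∇_w v)`. -/
theorem christoffel_compat {m : ℕ} {x : E m} (hx : x ∈ halfSpace m) (u v w : E m) :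
    HasDerivAt (fun t : ℝ => hypMetric (x + t • w) u v)
      (hypMetric x (christoffel x w u) v + hypMetric x u (christoffel x w v)) 0 := by
  have hx' : height x ≠ 0 := ne_of_gt hx
  have hl : ∀ y : E m, (inner ℝ (eLast m) y : ℝ) = height y := by
    intro y
    simp [eLast, height, EuclideanSpace.inner_single_left]
  have hl' : ∀ y : E m, (inner ℝ y (eLast m) : ℝ) = height y := by
    intro y
    rw [real_inner_comm, hl]
  have h1 : HasDerivAt (fun t : ℝ => height x + t * height w) (height w) 0 := by
    simpa using ((hasDerivAt_id (0 : ℝ)).mul_const (height w)).const_add (height x)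
  have h2 := (hasDerivAt_const (0 : ℝ) (inner ℝ u v : ℝ)).div (h1.pow 2)
    (by simpa using hx')
  have h3 : (fun t : ℝ => hypMetric (x + t • w) u v)
      = (fun _ : ℝ => (inner ℝ u v : ℝ)) / (fun t : ℝ => height x + t * height w) ^ 2 := by
    funext t
    simp [hypMetric, height]
  rw [h3]
  refine h2.congr_deriv ?_
  simp only [hypMetric, christoffel, inner_smul_left, inner_smul_right, inner_sub_left,
    inner_sub_right, inner_add_left, inner_add_right, hl, hl', conj_trivial, Pi.pow_apply,
    zero_mul, add_zero]
  rw [real_inner_comm w u]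
  field_simp
  ring

/-- The hyperbolic distance in the half-space model. -/
def hypDist {m : ℕ} (x y : E m) : ℝ :=
  2 * Real.artanh (Real.sqrt
    (((∑ i : Fin m, (x i.castSucc - y i.castSucc) ^ 2) + (height x - height y) ^ 2) /
      ((∑ i : Fin m, (x i.castSucc - y i.castSucc) ^ 2) + (height x + height y) ^ 2)))

/-- `Φ` restricts to an isometry of the hyperbolic space onto itself. -/
def IsHypIsometry {m : ℕ} (Φ : E m → E m) : Prop :=
  Set.BijOn Φ (halfSpace m) (halfSpace m) ∧
    ∀ x ∈ halfSpace m, ∀ y ∈ halfSpace m, hypDist (Φ x) (Φ y) = hypDist x y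

/-! ### Hypersurfaces, shape operator, mean curvature -/

/-- Near its point `p` the set `L` is the zero set in `U` of the smooth function `f`, which has no
critical point in `U`. A subset of the half-space is an embedded smooth hypersurface if and only if
it has such a local defining function at each of its points. -/
structure LocalDef {m : ℕ} (L : Set (E m)) (p : E m) (U : Set (E m)) (f : E m → ℝ) : Prop where
  isOpen : IsOpen U
  subset : U ⊆ halfSpace m
  mem : p ∈ U
  mem_set : p ∈ L
  smooth : ContDiffOn ℝ ∞ f U
  regular : ∀ x ∈ U, gradient f x ≠ 0
  zeroSet : L ∩ U = {x ∈ U | f x = 0}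

/-- The tangent space at `p` of the level hypersurface of `f` through `p`. -/
abbrev tangentSpace {m : ℕ} (f : E m → ℝ) (p : E m) : Submodule ℝ (E m) :=
  LinearMap.ker (fderiv ℝ f p).toLinearMap

/-- The unit normal field (for the hyperbolic metric) of the level hypersurfaces of `f`. -/
def unitNormal {m : ℕ} (f : E m → ℝ) (x : E m) : E m :=
  (height x / ‖gradient f x‖) • gradient f x

/-- The covariant derivative `v ↦ ∇_v N` at `p` of a vector field `N`. -/
def covDeriv {m : ℕ} (N : E m → E m) (p : E m) : E m →ₗ[ℝ] E m where
  toFun v := fderiv ℝ N p v + christoffel p v (N p)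
  map_add' u v := by
    simp only [map_add, christoffel, height, PiLp.add_apply, inner_add_left]
    module
  map_smul' c v := by
    simp only [map_smul, christoffel, height, PiLp.smul_apply, inner_smul_left, smul_eq_mul,
      conj_trivial, RingHom.id_apply]
    module

/-- The shape operator `v ↦ ∇_v N` on the tangent space, `N` being the unit normal field. The sign
is the one for which a horizontal hyperplane with downward normal has mean curvature `1`. The vector
`∇_v N` is tangent; the projection only makes this visible to the type. (The metric is conformal to
the Euclidean one, so that orthogonality has the same meaning for both.) -/
def shapeOperator {m : ℕ} (f : E m → ℝ) (p : E m) :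
    tangentSpace f p →ₗ[ℝ] tangentSpace f p :=
  (tangentSpace f p).orthogonalProjectionOnto.toLinearMap ∘ₗ
    covDeriv (unitNormal f) p ∘ₗ (tangentSpace f p).subtype

/-- The mean curvature at `p` of the level hypersurface of `f`, with respect to `unitNormal f`: the
average of the principal curvatures. -/
def meanCurvature {m : ℕ} (f : E m → ℝ) (p : E m) : ℝ :=
  LinearMap.trace ℝ (tangentSpace f p) (shapeOperator f p) / m

/-- The hypersurface `L` has mean curvature `k` at `p` for the orientation by the unit normal that
points to the same side as `w`. -/
def HasMeanCurvature {m : ℕ} (L : Set (E m)) (p w : E m) (k : ℝ) : Prop :=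
  ∃ (U : Set (E m)) (f : E m → ℝ), LocalDef L p U f ∧
    0 < hypMetric p (unitNormal f p) w ∧ meanCurvature f p = k

/-- `p` is an umbilical point of the hypersurface `L`. -/
def IsUmbilicalAt {m : ℕ} (L : Set (E m)) (p : E m) : Prop :=
  ∃ (U : Set (E m)) (f : E m → ℝ), LocalDef L p U f ∧
    ∃ k : ℝ, shapeOperator f p = k • LinearMap.id

/-- `L` is a totally geodesic hypersurface: its second fundamental form vanishes identically. -/
def IsTotallyGeodesic {m : ℕ} (L : Set (E m)) : Prop :=
  L.Nonempty ∧ L ⊆ halfSpace m ∧ ∀ p ∈ L, ∃ (U : Set (E m)) (f : E m → ℝ),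
    LocalDef L p U f ∧ shapeOperator f p = 0

/-- The vector `w` at the point `p` of the hypersurface `L` is orthogonal to `L`. -/
def IsNormalTo {m : ℕ} (L : Set (E m)) (p w : E m) : Prop :=
  ∃ (U : Set (E m)) (f : E m → ℝ), LocalDef L p U f ∧
    ∀ v ∈ tangentSpace f p, hypMetric p w v = 0

/-! ### Generalized hyperspheres -/

/-- A horosphere: a horizontal hyperplane, or a sphere tangent to the ideal boundary `height = 0`
from above, without the point of tangency. -/
def IsHorosphere {m : ℕ} (L : Set (E m)) : Prop :=
  (∃ a : ℝ, 0 < a ∧ L = {x | height x = a}) ∨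
  (∃ (c : E m) (R : ℝ), 0 < R ∧ height c = R ∧ L = Metric.sphere c R ∩ halfSpace m)

/-- The part in the half-space of a sphere or hyperplane that meets the hyperplane `height = 0`
transversely. Those that meet it orthogonally (`height c = 0`, resp. `height u = 0`) are the totally
geodesic ones, the others are the hyperspheres in the strict sense. -/
def IsHypersphere {m : ℕ} (L : Set (E m)) : Prop :=
  (∃ (c : E m) (R : ℝ), |height c| < R ∧ L = Metric.sphere c R ∩ halfSpace m) ∨
  (∃ (u : E m) (b : ℝ), ‖u‖ = 1 ∧ |height u| < 1 ∧
    L = {x | (inner ℝ u x : ℝ) = b} ∩ halfSpace m)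

/-- A generalized hypersphere: a horosphere, a hypersphere or a complete totally geodesic
hypersurface. -/
def IsGenHypersphere {m : ℕ} (L : Set (E m)) : Prop := IsHorosphere L ∨ IsHypersphere L

/-- A vertical hyperplane of the half-space. -/
def IsVerticalHyperplane {m : ℕ} (L : Set (E m)) : Prop :=
  ∃ (u : E m) (b : ℝ), ‖u‖ = 1 ∧ height u = 0 ∧ L = {x | (inner ℝ u x : ℝ) = b} ∩ halfSpace m

/-! ### Horocycles -/

/-- The covariant acceleration `∇_{γ'} γ'` of a curve. -/
def hypAccel {m : ℕ} (γ : ℝ → E m) (t : ℝ) : E m :=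
  deriv (deriv γ) t + christoffel (γ t) (deriv γ t) (deriv γ t)

/-- `γ` is an arc-length parametrized horocycle: a complete geodesic of a horosphere `S`, i.e. a
unit speed curve in `S`, defined on the whole line, with acceleration everywhere normal to `S`. -/
def IsHorocycle {m : ℕ} (γ : ℝ → E m) : Prop :=
  ∃ S : Set (E m), IsHorosphere S ∧ ContDiff ℝ 2 γ ∧ ∀ t : ℝ, γ t ∈ S ∧
    hypMetric (γ t) (deriv γ t) (deriv γ t) = 1 ∧ IsNormalTo S (γ t) (hypAccel γ t)

/-- `γ` parametrizes a line parallel to the hyperplane `height = 0`. -/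
def IsHorizontalLine {m : ℕ} (γ : ℝ → E m) : Prop :=
  ∃ p w : E m, w ≠ 0 ∧ height w = 0 ∧ ∀ t : ℝ, γ t = p + t • w

/-- `γ` meets `L` in exactly one point, and there orthogonally. -/
def MeetsOnceOrthogonally {m : ℕ} (γ : ℝ → E m) (L : Set (E m)) : Prop :=
  ∃ t : ℝ, (∀ s : ℝ, γ s ∈ L ↔ s = t) ∧ IsNormalTo L (γ t) (deriv γ t)

/-! ### Foliations of codimension one and umbilical routes -/

/-- The plaque through `p` of a foliated chart `φ`. -/
def plaque {m : ℕ} (φ : OpenPartialHomeomorph (E m) (EuclideanSpace ℝ (Fin m) × ℝ)) (p : E m) :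
    Set (E m) :=
  {q ∈ φ.source | (φ q).2 = (φ p).2}

/-- A foliation of codimension one of the half-space, given by a foliated atlas. It is transversely
of class `C⁰` and has smooth leaves: all derivatives along the plaques exist and are continuous. -/
structure Foliation (m : ℕ) where
  charts : Set (OpenPartialHomeomorph (E m) (EuclideanSpace ℝ (Fin m) × ℝ))
  source_subset : ∀ φ ∈ charts, φ.source ⊆ halfSpace m
  target_eq : ∀ φ ∈ charts, φ.target = Set.univ
  cover : ∀ p ∈ halfSpace m, ∃ φ ∈ charts, p ∈ φ.source
  plaque_smooth : ∀ φ ∈ charts, ∀ s : ℝ,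
    ContDiff ℝ ∞ (fun x : EuclideanSpace ℝ (Fin m) => φ.symm (x, s))
  plaque_immersed : ∀ φ ∈ charts, ∀ (x : EuclideanSpace ℝ (Fin m)) (s : ℝ),
    Function.Injective (fderiv ℝ (fun y : EuclideanSpace ℝ (Fin m) => φ.symm (y, s)) x)
  plaque_continuous : ∀ φ ∈ charts, ∀ k : ℕ, Continuous
    (fun q : EuclideanSpace ℝ (Fin m) × ℝ =>
      iteratedFDeriv ℝ k (fun y : EuclideanSpace ℝ (Fin m) => φ.symm (y, q.2)) q.1)
  compatible : ∀ φ ∈ charts, ∀ ψ ∈ charts, ∀ x ∈ φ.source ∩ ψ.source,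
    ∃ W : Set (E m), IsOpen W ∧ x ∈ W ∧ W ⊆ φ.source ∩ ψ.source ∧
      ∀ y ∈ W, ∀ z ∈ W, (φ y).2 = (φ z).2 ↔ (ψ y).2 = (ψ z).2

/-- Two points lie in a common plaque. -/
def Foliation.SamePlaque {m : ℕ} (F : Foliation m) (p q : E m) : Prop :=
  ∃ φ ∈ F.charts, p ∈ φ.source ∧ q ∈ plaque φ p

/-- The leaf through `p`: all points that a finite chain of plaques joins to `p`. -/
def Foliation.leaf {m : ℕ} (F : Foliation m) (p : E m) : Set (E m) :=
  {q | Relation.ReflTransGen F.SamePlaque p q}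

/-- Every point of every leaf is umbilical. (Plaques are open in their leaves.) -/
def Foliation.IsTotallyUmbilical {m : ℕ} (F : Foliation m) : Prop :=
  ∀ φ ∈ F.charts, ∀ p ∈ φ.source, IsUmbilicalAt (plaque φ p) p

/-- `h` is an umbilical route along the curve `γ`: there are generalized hyperspheres `L t`,
orthogonal to `γ` at `γ t` and with mean curvature `h t` there (for the orientation opposite to
`γ`), which are leaves of a totally umbilical foliation of the hyperbolic space. -/
def IsUmbilicalRoute {m : ℕ} (γ : ℝ → E m) (h : ℝ → ℝ) : Prop :=
  ∃ L : ℝ → Set (E m),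
    (∀ t : ℝ, IsGenHypersphere (L t) ∧ γ t ∈ L t ∧ IsNormalTo (L t) (γ t) (deriv γ t) ∧
      HasMeanCurvature (L t) (γ t) (-deriv γ t) (h t)) ∧
    ∃ F : Foliation m, F.IsTotallyUmbilical ∧ ∀ t : ℝ, L t = F.leaf (γ t)

end HypUmb

end

open scoped ContDiff

noncomputable section

namespace HypUmb

open Filter Topology EuclideanGeometry

variable {m : ℕ}

/-! ### The height function -/

/-! Spheres and hyperplanes are treated together as zero sets of `a‖x‖² + ⟪b, x⟫ + d`, normalized so
that the gradient is a unit vector on the zero set. In the half-space metric such a hypersurface has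
shape operator `±height b` times the identity (`Quadric.shapeOperator_eq`). Generalized hyperspheres
satisfy `|height b| ≤ 1`, and `height b = 0` makes them totally geodesic. An inversion centred on
the ideal boundary is an isometry that permutes these quadrics and preserves `height b`, and such an
inversion or the identity turns any horocycle into a horizontal line `p + t • w`
(`IsHorocycle.exists_normalForm`).

A quadric orthogonal to this line has a horizontal gradient at the common point, whence `height b =
-2 a height p`: it is totally geodesic as soon as `a = 0`. If `a ≠ 0`, its equation restricted to
the line has a second root, so meeting the line only once forces a vertical hyperplane.

For a route, the leaves are cut with the vertical half-plane above the line. Up to scale, a leaf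
with `a ≠ 0` becomes an arc of a circle centred on the line. The leaf through the centre is
orthogonal to the line too and must avoid that circle, so it is a circle of less than half the
diameter. Repeating this gives arbitrarily small diameters, but `|height b| ≤ 1` bounds them below
(`eq_zero_of_noncrossing`). Hence `a = 0` for all leaves, and their mean curvature vanishes.
Conversely, the hyperplanes orthogonal to the line, carried back by the isometry, form a foliation
with totally geodesic leaves. -/

theorem height_add (x y : E m) : height (x + y) = height x + height y := rfl

theorem height_sub (x y : E m) : height (x - y) = height x - height y := rfl

theorem height_smul (c : ℝ) (x : E m) : height (c • x) = c * height x := rfl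

theorem height_neg (x : E m) : height (-x) = -height x := rfl

theorem inner_eLast (x : E m) : (inner ℝ (eLast m) x : ℝ) = height x := by
  simp [eLast, height, EuclideanSpace.inner_single_left]

theorem inner_eLast_right (x : E m) : (inner ℝ x (eLast m) : ℝ) = height x := by
  rw [real_inner_comm, inner_eLast]

theorem height_eLast : height (eLast m) = 1 := by simp [eLast, height]

theorem norm_eLast : ‖eLast m‖ = 1 := by simp [eLast]

theorem contDiff_height : ContDiff ℝ ∞ (height : E m → ℝ) :=
  (EuclideanSpace.proj (𝕜 := ℝ) (Fin.last m) : E m →L[ℝ] ℝ).contDiff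

theorem continuous_height : Continuous (height : E m → ℝ) := contDiff_height.continuous

theorem isOpen_halfSpace : IsOpen (halfSpace m) := isOpen_lt continuous_const continuous_height

theorem _root_.HasDerivAt.height {c : ℝ → E m} {v : E m} {t : ℝ} (h : HasDerivAt c v t) :
    HasDerivAt (fun s => HypUmb.height (c s)) (HypUmb.height v) t :=
  ((EuclideanSpace.proj (𝕜 := ℝ) (Fin.last m) : E m →L[ℝ] ℝ).hasFDerivAt.comp_hasDerivAt t h)

theorem hypMetric_eq_zero {x u v : E m} (hx : x ∈ halfSpace m) :
    hypMetric x u v = 0 ↔ (inner ℝ u v : ℝ) = 0 := by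
  have : height x ≠ 0 := ne_of_gt hx
  simp [hypMetric, this]

/-! ### Normalized quadrics -/

/-- The equation `a ‖x‖² + ⟪b, x⟫ + d = 0` of a Euclidean sphere or hyperplane, normalized so that
its gradient has length one along the zero set. -/
structure Quadric (m : ℕ) where
  a : ℝ
  b : E m
  d : ℝ
  normalized : ‖b‖ ^ 2 - 4 * a * d = 1

namespace Quadric

variable (Q : Quadric m)

def eval (x : E m) : ℝ := Q.a * ‖x‖ ^ 2 + inner ℝ Q.b x + Q.d

def grad (x : E m) : E m := (2 * Q.a) • x + Q.b

/-- The zero set in the half-space. -/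
def locus : Set (E m) := {x ∈ halfSpace m | Q.eval x = 0}

instance : Neg (Quadric m) where
  neg Q := ⟨-Q.a, -Q.b, -Q.d, by rw [norm_neg]; linarith [Q.normalized]⟩

theorem eval_neg (x : E m) : (-Q).eval x = -Q.eval x := by
  change -Q.a * ‖x‖ ^ 2 + inner ℝ (-Q.b) x + -Q.d = -(Q.a * ‖x‖ ^ 2 + inner ℝ Q.b x + Q.d)
  rw [inner_neg_left]; ring

theorem grad_neg (x : E m) : (-Q).grad x = -Q.grad x := by
  change (2 * -Q.a) • x + -Q.b = -((2 * Q.a) • x + Q.b)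
  module

theorem locus_neg : (-Q).locus = Q.locus := by
  ext x; simp [locus, eval_neg]

theorem eval_add (x y : E m) :
    Q.eval (x + y) = Q.eval x + inner ℝ (Q.grad x) y + Q.a * ‖y‖ ^ 2 := by
  simp only [eval, grad, norm_add_sq_real, inner_add_right, inner_add_left, inner_smul_left,
    conj_trivial]
  ring

/-- The discriminant of a quadratic polynomial does not depend on the point at which it is expanded.
On the zero set this leaves a gradient of length one. -/
theorem norm_grad_sq (x : E m) : ‖Q.grad x‖ ^ 2 = 4 * Q.a * Q.eval x + 1 := by
  rw [grad, norm_add_sq_real, norm_smul, mul_pow, inner_smul_left, real_inner_comm,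
    ← Q.normalized, Real.norm_eq_abs, sq_abs, eval]
  simp only [conj_trivial]
  ring

theorem norm_grad {x : E m} (hx : Q.eval x = 0) : ‖Q.grad x‖ = 1 := by
  have := Q.norm_grad_sq x
  rw [hx] at this
  exact (pow_eq_one_iff_of_nonneg (norm_nonneg _) two_ne_zero).1 (by linarith)

theorem inner_grad_self {x : E m} (hx : Q.eval x = 0) :
    (inner ℝ (Q.grad x) (Q.grad x) : ℝ) = 1 := by
  rw [real_inner_self_eq_norm_sq, Q.norm_grad hx, one_pow]

theorem grad_ne_zero {x : E m} (hx : Q.eval x = 0) : Q.grad x ≠ 0 := by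
  rw [← norm_ne_zero_iff, Q.norm_grad hx]; exact one_ne_zero

theorem contDiff_eval : ContDiff ℝ ∞ Q.eval := by
  unfold eval
  exact ((contDiff_const.mul (contDiff_norm_sq ℝ)).add (contDiff_const.inner ℝ contDiff_id)).add
    contDiff_const

theorem continuous_grad : Continuous Q.grad := by unfold grad; fun_prop

theorem hasFDerivAt_eval (x : E m) : HasFDerivAt Q.eval (innerSL ℝ (Q.grad x)) x := by
  have h := (((hasStrictFDerivAt_norm_sq x).hasFDerivAt.const_mul Q.a).add
    ((innerSL ℝ Q.b).hasFDerivAt (x := x))).add_const Q.d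
  refine h.congr_fderiv ?_
  ext v
  simp [grad]
  ring

theorem gradient_eval (x : E m) : gradient Q.eval x = Q.grad x := by
  refine HasGradientAt.gradient ?_
  rw [hasGradientAt_iff_hasFDerivAt]
  exact Q.hasFDerivAt_eval x

/-- A curve in the zero set through `p` with velocity `v`, for tangent vectors `v`. -/
def curve (p v : E m) (t : ℝ) : E m :=
  p + (1 + Q.a ^ 2 * t ^ 2 * ‖v‖ ^ 2)⁻¹ • (t • v - (Q.a * t ^ 2 * ‖v‖ ^ 2) • Q.grad p)

variable {Q}

theorem curve_zero (p v : E m) : Q.curve p v 0 = p := by simp [curve]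

/-- With `g = Q.grad p`, the line from `p` in direction `t v - a t²‖v‖² g` meets the quadric again
at the parameter `(1 + a² t² ‖v‖²)⁻¹`, which is the factor in `curve`. -/
theorem eval_curve {p v : E m} (hp : Q.eval p = 0) (hv : (inner ℝ (Q.grad p) v : ℝ) = 0) (t : ℝ) :
    Q.eval (Q.curve p v t) = 0 := by
  have h1 : 1 + Q.a ^ 2 * t ^ 2 * ‖v‖ ^ 2 ≠ 0 := by positivity
  have h2 : (inner ℝ v (Q.grad p) : ℝ) = 0 := by rw [real_inner_comm, hv]
  rw [curve, eval_add, hp, ← real_inner_self_eq_norm_sq (_ • _)]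
  simp only [inner_smul_left, inner_smul_right, inner_sub_left, inner_sub_right, hv, h2,
    Q.inner_grad_self hp, conj_trivial, real_inner_self_eq_norm_sq]
  field_simp
  ring

theorem hasDerivAt_curve (p v : E m) : HasDerivAt (Q.curve p v) v 0 := by
  have h0 : HasDerivAt (fun t : ℝ => t ^ 2) 0 0 := by
    simpa using hasDerivAt_pow 2 (0 : ℝ)
  have h1 : HasDerivAt (fun t : ℝ => 1 + Q.a ^ 2 * t ^ 2 * ‖v‖ ^ 2) 0 0 := by
    simpa using ((h0.const_mul (Q.a ^ 2)).mul_const (‖v‖ ^ 2)).const_add 1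
  have h2 : HasDerivAt (fun t : ℝ => (1 + Q.a ^ 2 * t ^ 2 * ‖v‖ ^ 2)⁻¹) 0 0 := by
    simpa using h1.fun_inv (by simp)
  have h3 : HasDerivAt (fun t : ℝ => t • v - (Q.a * t ^ 2 * ‖v‖ ^ 2) • Q.grad p) v 0 := by
    simpa using ((hasDerivAt_id (0 : ℝ)).smul_const v).fun_sub
      (((h0.const_mul Q.a).mul_const (‖v‖ ^ 2)).smul_const (Q.grad p))
  have h4 := (h2.fun_smul h3).const_add p
  simp only [ne_eq, OfNat.ofNat_ne_zero, not_false_eq_true, zero_pow, mul_zero, zero_mul, add_zero,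
    inv_one, one_smul, zero_smul] at h4
  exact h4

end Quadric

/-! ### The geometry of a quadric read off from an arbitrary local equation -/

theorem LocalDef.differentiableAt {L U : Set (E m)} {p : E m} {f : E m → ℝ}
    (hf : LocalDef L p U f) : DifferentiableAt ℝ f p :=
  (hf.smooth.contDiffAt (hf.isOpen.mem_nhds hf.mem)).differentiableAt (by simp)

theorem LocalDef.of_mem {L U : Set (E m)} {p q : E m} {f : E m → ℝ}
    (hf : LocalDef L p U f) (hq : q ∈ U) (hqL : q ∈ L) : LocalDef L q U f :=
  { hf with mem := hq, mem_set := hqL }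

theorem contDiffOn_gradient {U : Set (E m)} {f : E m → ℝ} (hU : IsOpen U)
    (hf : ContDiffOn ℝ ∞ f U) : ContDiffOn ℝ ∞ (gradient f) U :=
  (InnerProductSpace.toDual ℝ (E m)).symm.toContinuousLinearEquiv.contDiff.comp_contDiffOn
    (hf.fderiv_of_isOpen hU (by simp))

namespace Quadric

variable {Q : Quadric m} {p : E m} {U : Set (E m)} {f : E m → ℝ}

/-- The curve stays in the zero set of the local equation. -/
theorem eventually_curve (hf : LocalDef Q.locus p U f) {v : E m}
    (hv : (inner ℝ (Q.grad p) v : ℝ) = 0) :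
    ∀ᶠ t in 𝓝 (0 : ℝ), Q.curve p v t ∈ U ∩ Q.locus := by
  have hc : ContinuousAt (Q.curve p v) 0 := (hasDerivAt_curve p v).continuousAt
  have hU : U ∈ 𝓝 (Q.curve p v 0) := by rw [curve_zero]; exact hf.isOpen.mem_nhds hf.mem
  filter_upwards [hc hU] with t ht
  exact ⟨ht, hf.subset ht, eval_curve hf.mem_set.2 hv t⟩

/-- Since `f` vanishes along the curves in the quadric, its gradient is orthogonal to every vector
orthogonal to the unit vector `Q.grad p`. This makes the later computations independent of the local
equation. -/
theorem gradient_eq (hf : LocalDef Q.locus p U f) :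
    gradient f p = (inner ℝ (gradient f p) (Q.grad p) : ℝ) • Q.grad p := by
  have key : ∀ v : E m, (inner ℝ (Q.grad p) v : ℝ) = 0 → (inner ℝ (gradient f p) v : ℝ) = 0 := by
    intro v hv
    rw [inner_gradient_left]
    have h1 : HasFDerivAt f (fderiv ℝ f p) (Q.curve p v 0) := by
      rw [curve_zero]; exact hf.differentiableAt.hasFDerivAt
    have h2 := h1.comp_hasDerivAt 0 (hasDerivAt_curve (Q := Q) p v)
    have h3 : (f ∘ Q.curve p v) =ᶠ[𝓝 0] fun _ => (0 : ℝ) := by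
      filter_upwards [eventually_curve hf hv] with t ht
      exact (hf.zeroSet.subset ⟨ht.2, ht.1⟩).2
    exact h2.unique ((hasDerivAt_const (0 : ℝ) (0 : ℝ)).congr_of_eventuallyEq h3)
  set k : ℝ := inner ℝ (gradient f p) (Q.grad p)
  have h1 : (inner ℝ (Q.grad p) (gradient f p - k • Q.grad p) : ℝ) = 0 := by
    rw [inner_sub_right, inner_smul_right, Q.inner_grad_self hf.mem_set.2, real_inner_comm]
    simp [k]
  have h2 : (inner ℝ (gradient f p - k • Q.grad p) (gradient f p - k • Q.grad p) : ℝ) = 0 := by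
    rw [inner_sub_left, key _ h1, inner_smul_left, h1]; simp
  exact sub_eq_zero.1 (inner_self_eq_zero.1 h2)

theorem inner_gradient_ne_zero (hf : LocalDef Q.locus p U f) :
    (inner ℝ (gradient f p) (Q.grad p) : ℝ) ≠ 0 := by
  intro h
  apply hf.regular p hf.mem
  rw [gradient_eq hf, h, zero_smul]

theorem mem_tangentSpace (hf : LocalDef Q.locus p U f) (v : E m) :
    v ∈ tangentSpace f p ↔ (inner ℝ (Q.grad p) v : ℝ) = 0 := by
  rw [LinearMap.mem_ker, ContinuousLinearMap.coe_coe, ← inner_gradient_left, gradient_eq hf,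
    inner_smul_left, mul_eq_zero]
  exact or_iff_right (inner_gradient_ne_zero hf)

theorem unitNormal_eq (hf : LocalDef Q.locus p U f) {s : ℝ} (hs : s = 1 ∨ s = -1)
    (h : 0 < s * (inner ℝ (gradient f p) (Q.grad p) : ℝ)) :
    unitNormal f p = (s * height p) • Q.grad p := by
  set k : ℝ := inner ℝ (gradient f p) (Q.grad p) with hk
  have h1 : ‖gradient f p‖ = s * k := by
    rw [gradient_eq hf, norm_smul, Q.norm_grad hf.mem_set.2, mul_one, ← hk, Real.norm_eq_abs,
      ← abs_of_pos h, abs_mul]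
    rcases hs with rfl | rfl <;> simp
  have hs2 : s * s = 1 := by rcases hs with rfl | rfl <;> simp
  have hk0 : k ≠ 0 := inner_gradient_ne_zero hf
  have hs0 : s ≠ 0 := by rintro rfl; simp at hs2
  rw [unitNormal, h1, gradient_eq hf, ← hk, smul_smul]
  congr 1
  field_simp
  linear_combination (-height p) * hs2

/-- Spheres and hyperplanes are totally umbilical. -/
theorem shapeOperator_eq (hf : LocalDef Q.locus p U f) :
    ∃ s : ℝ, shapeOperator f p = (-(s * height Q.b)) • LinearMap.id := by
  have hk0 := inner_gradient_ne_zero hf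
  obtain ⟨s, hs, hsk⟩ : ∃ s : ℝ, (s = 1 ∨ s = -1) ∧
      0 < s * (inner ℝ (gradient f p) (Q.grad p) : ℝ) := by
    rcases lt_or_gt_of_ne hk0 with h | h
    · exact ⟨-1, Or.inr rfl, by linarith⟩
    · exact ⟨1, Or.inl rfl, by linarith⟩
  have hp0 : height p ≠ 0 := ne_of_gt hf.mem_set.1
  have hgrad := contDiffOn_gradient hf.isOpen hf.smooth
  have hgradp : ContDiffAt ℝ ∞ (gradient f) p := hgrad.contDiffAt (hf.isOpen.mem_nhds hf.mem)
  have hN : DifferentiableAt ℝ (unitNormal f) p := by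
    have h1 : ContDiffAt ℝ ∞ (unitNormal f) p :=
      (contDiff_height.contDiffAt.div (hgradp.norm ℝ (hf.regular p hf.mem))
        (norm_ne_zero_iff.2 (hf.regular p hf.mem))).smul hgradp
    exact h1.differentiableAt (by simp)
  have hcov : ∀ v : E m, (inner ℝ (Q.grad p) v : ℝ) = 0 →
      covDeriv (unitNormal f) p v = (-(s * height Q.b)) • v := by
    intro v hv
    have hc := hasDerivAt_curve (Q := Q) p v
    have h1 : HasFDerivAt (unitNormal f) (fderiv ℝ (unitNormal f) p) (Q.curve p v 0) := by
      rw [curve_zero]; exact hN.hasFDerivAt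
    have h2 := h1.comp_hasDerivAt 0 hc
    -- The sign `s` chosen at `p` stays valid along the curve by continuity. There the normal of the
    -- unknown equation `f` agrees with an explicit field, which can be differentiated.
    have h3 : (unitNormal f ∘ Q.curve p v) =ᶠ[𝓝 0]
        fun t => (s * height (Q.curve p v t)) • Q.grad (Q.curve p v t) := by
      have hcont : ContinuousAt (fun t => s * (inner ℝ (gradient f (Q.curve p v t))
          (Q.grad (Q.curve p v t)) : ℝ)) 0 := by
        have hg : ContinuousAt (gradient f) (Q.curve p v 0) := by
          rw [curve_zero]; exact hgradp.continuousAt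
        exact continuousAt_const.mul ((hg.comp hc.continuousAt).inner
          (Q.continuous_grad.continuousAt.comp hc.continuousAt))
      have hpos0 : 0 < s * (inner ℝ (gradient f (Q.curve p v 0)) (Q.grad (Q.curve p v 0)) : ℝ) := by
        rw [curve_zero]; exact hsk
      have hpos : ∀ᶠ t in 𝓝 (0 : ℝ), 0 < s * (inner ℝ (gradient f (Q.curve p v t))
          (Q.grad (Q.curve p v t)) : ℝ) :=
        hcont.eventually_const_lt hpos0
      filter_upwards [eventually_curve hf hv, hpos] with t ht ht'
      exact unitNormal_eq (hf.of_mem ht.1 ht.2) hs ht'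
    have h4 : HasDerivAt (fun t => (s * height (Q.curve p v t)) • Q.grad (Q.curve p v t))
        ((s * height p) • ((2 * Q.a) • v) + (s * height v) • Q.grad p) 0 := by
      have := (hc.height.const_mul s).fun_smul ((hc.const_smul (2 * Q.a)).add_const Q.b)
      simpa [curve_zero, grad] using this
    have h5 := h2.unique (h4.congr_of_eventuallyEq h3)
    have hgv : (inner ℝ v (Q.grad p) : ℝ) = 0 := by rw [real_inner_comm, hv]
    change fderiv ℝ (unitNormal f) p v + christoffel p v (unitNormal f p) = _
    rw [h5, unitNormal_eq hf hs hsk, christoffel, inner_smul_right, hgv, height_smul, mul_zero,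
      zero_smul, sub_zero]
    have hgh : height (Q.grad p) = 2 * Q.a * height p + height Q.b := rfl
    rw [hgh]
    -- The Christoffel term cancels both the multiple of `Q.grad p` and the part `2 s a height p` of
    -- the coefficient of `v`; only `-s height Q.b` survives.
    have e1 : (height p)⁻¹ * height p = 1 := inv_mul_cancel₀ hp0
    match_scalars
    · linear_combination (-(2 * s * Q.a * height p) - s * height Q.b) * e1
    · linear_combination (-(s * height v)) * e1
  refine ⟨s, ?_⟩
  ext1 v
  have hv : (inner ℝ (Q.grad p) v : ℝ) = 0 := (mem_tangentSpace hf _).1 v.2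
  change (tangentSpace f p).orthogonalProjectionOnto (covDeriv (unitNormal f) p v) = _
  rw [hcov _ hv, map_smul, Submodule.orthogonalProjectionOnto_mem_subspace_eq_self]
  rfl

theorem shapeOperator_eq_zero (hf : LocalDef Q.locus p U f) (hb : height Q.b = 0) :
    shapeOperator f p = 0 := by
  obtain ⟨s, hs⟩ := shapeOperator_eq hf
  rw [hs, hb]; simp

/-- The part of `w` orthogonal to the unit gradient is tangent, hence orthogonal to `w`, hence to
itself. -/
theorem isNormalTo {w : E m} (hw : IsNormalTo Q.locus p w) :
    w = (inner ℝ (Q.grad p) w : ℝ) • Q.grad p := by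
  obtain ⟨U, f, hf, h⟩ := hw
  set k : ℝ := inner ℝ (Q.grad p) w with hk
  have h1 : (inner ℝ (Q.grad p) (w - k • Q.grad p) : ℝ) = 0 := by
    rw [inner_sub_right, inner_smul_right, Q.inner_grad_self hf.mem_set.2]
    simp [k]
  have h3 := (hypMetric_eq_zero hf.mem_set.1).1 (h _ ((mem_tangentSpace hf _).2 h1))
  have h2 : (inner ℝ (w - k • Q.grad p) (w - k • Q.grad p) : ℝ) = 0 := by
    rw [inner_sub_left, h3, inner_smul_left, h1]; simp
  exact sub_eq_zero.1 (inner_self_eq_zero.1 h2)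

variable (Q)

/-- The equation itself is a local equation, where its gradient does not vanish. -/
theorem localDef {p : E m} (hp : p ∈ Q.locus) :
    LocalDef Q.locus p {x ∈ halfSpace m | Q.grad x ≠ 0} Q.eval where
  isOpen := isOpen_halfSpace.inter (isOpen_ne_fun Q.continuous_grad continuous_const)
  subset := fun _ h => h.1
  mem := ⟨hp.1, Q.grad_ne_zero hp.2⟩
  mem_set := hp
  smooth := Q.contDiff_eval.contDiffOn
  regular := fun x hx => by rw [Q.gradient_eval]; exact hx.2
  zeroSet := by
    ext x
    constructor
    · rintro ⟨h1, h2⟩; exact ⟨h2, h1.2⟩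
    · rintro ⟨h1, h2⟩; exact ⟨⟨h1.1, h2⟩, h1⟩

variable {Q}

theorem isTotallyGeodesic (hne : Q.locus.Nonempty) (hb : height Q.b = 0) :
    IsTotallyGeodesic Q.locus :=
  ⟨hne, fun _ h => h.1, fun _ hp => ⟨_, _, Q.localDef hp,
    shapeOperator_eq_zero (Q.localDef hp) hb⟩⟩

theorem isNormalTo_of_eq_smul (hp : p ∈ Q.locus) {w : E m} {k : ℝ} (h : w = k • Q.grad p) :
    IsNormalTo Q.locus p w := by
  refine ⟨_, _, Q.localDef hp, fun v hv => (hypMetric_eq_zero hp.1).2 ?_⟩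
  rw [h, inner_smul_left, (mem_tangentSpace (Q.localDef hp) v).1 hv, mul_zero]

theorem hasMeanCurvature_zero (hp : p ∈ Q.locus) (hb : height Q.b = 0) {w : E m} {k : ℝ}
    (hk : k ≠ 0) (h : w = k • Q.grad p) : HasMeanCurvature Q.locus p w 0 := by
  -- Negating the equation keeps the zero set and reverses the normal.
  wlog hk0 : 0 < k generalizing Q k
  · have := this (Q := -Q) (k := -k) (by rwa [locus_neg]) (by
      change height (-Q.b) = 0; rw [height_neg, hb, neg_zero]) (neg_ne_zero.2 hk)
      (by rw [grad_neg, h]; module) (by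
        rcases lt_or_gt_of_ne hk with h | h
        · linarith
        · exact absurd h hk0)
    rwa [locus_neg] at this
  have hL := Q.localDef hp
  refine ⟨_, _, hL, ?_, ?_⟩
  · have hp0 : 0 < height p := hp.1
    rw [unitNormal_eq hL (Or.inl rfl) (by
      rw [Q.gradient_eval, Q.inner_grad_self hp.2]; norm_num), h, hypMetric, inner_smul_left,
      inner_smul_right, Q.inner_grad_self hp.2]
    simp only [conj_trivial]
    positivity
  · rw [meanCurvature, shapeOperator_eq_zero hL hb, map_zero, zero_div]

theorem meanCurvature_eq_zero (hb : height Q.b = 0) {w : E m} {k : ℝ}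
    (h : HasMeanCurvature Q.locus p w k) : k = 0 := by
  obtain ⟨U, f, hf, -, rfl⟩ := h
  rw [meanCurvature, shapeOperator_eq_zero hf hb, map_zero, zero_div]

end Quadric

/-! ### Generalized hyperspheres are quadrics -/

/-- The hyperplane `⟪u, x⟫ = b`. -/
def Quadric.plane (u : E m) (hu : ‖u‖ = 1) (b : ℝ) : Quadric m := ⟨0, u, -b, by rw [hu]; ring⟩

theorem Quadric.locus_plane (u : E m) (hu : ‖u‖ = 1) (b : ℝ) :
    (Quadric.plane u hu b).locus = {x | (inner ℝ u x : ℝ) = b} ∩ halfSpace m := by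
  ext x
  simp only [locus, eval, plane, Set.mem_ofPred_eq, Set.mem_inter_iff, zero_mul, zero_add,
    and_comm, ← sub_eq_add_neg, sub_eq_zero]

/-- The sphere with centre `c` and radius `R`. -/
def Quadric.sphere (c : E m) (R : ℝ) (hR : 0 < R) : Quadric m :=
  ⟨(2 * R)⁻¹, (-R⁻¹) • c, (‖c‖ ^ 2 - R ^ 2) / (2 * R), by
    rw [norm_smul, mul_pow, Real.norm_eq_abs, sq_abs]
    field_simp
    ring⟩

theorem Quadric.locus_sphere (c : E m) (R : ℝ) (hR : 0 < R) :
    (Quadric.sphere c R hR).locus = Metric.sphere c R ∩ halfSpace m := by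
  ext x
  have h1 : (Quadric.sphere c R hR).eval x = (‖x - c‖ ^ 2 - R ^ 2) / (2 * R) := by
    simp only [eval, sphere, norm_sub_sq_real, inner_smul_left, conj_trivial, real_inner_comm x c]
    field_simp
    ring
  have h2 : ‖x - c‖ ^ 2 - R ^ 2 = 0 ↔ ‖x - c‖ = R := by
    rw [sub_eq_zero, pow_left_inj₀ (norm_nonneg _) hR.le two_ne_zero]
  have h3 : (2 * R) ≠ 0 := by positivity
  simp only [locus, Set.mem_ofPred_eq, h1, div_eq_zero_iff, h3, or_false, h2, Set.mem_inter_iff,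
    mem_sphere_iff_norm, and_comm]

theorem Quadric.grad_sphere (c : E m) (R : ℝ) (hR : 0 < R) (x : E m) :
    (Quadric.sphere c R hR).grad x = R⁻¹ • (x - c) := by
  simp only [grad, sphere]
  match_scalars <;> field_simp

/-- The bound on `height Q.b` bounds the principal curvatures by one. It later keeps the Euclidean
size of the leaves away from zero. -/
theorem IsGenHypersphere.exists_quadric {L : Set (E m)} (h : IsGenHypersphere L) :
    ∃ Q : Quadric m, height Q.b ^ 2 ≤ 1 ∧ L = Q.locus := by
  have hs : ∀ (c : E m) (R : ℝ) (hR : 0 < R), |height c| ≤ R →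
      height (Quadric.sphere c R hR).b ^ 2 ≤ 1 := by
    intro c R hR h
    change height ((-R⁻¹) • c) ^ 2 ≤ 1
    have : height c ^ 2 ≤ R ^ 2 := sq_le_sq' (abs_le.1 h).1 (abs_le.1 h).2
    rw [height_smul, neg_mul, neg_sq, mul_pow, inv_pow]
    exact inv_mul_le_one_of_le₀ this (by positivity)
  rcases h with (⟨a, ha, rfl⟩ | ⟨c, R, hR, hc, rfl⟩) | (⟨c, R, hc, rfl⟩ | ⟨u, b, hu, hu', rfl⟩)
  · refine ⟨Quadric.plane (eLast m) norm_eLast a, ?_, ?_⟩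
    · simp [Quadric.plane, height_eLast]
    · rw [Quadric.locus_plane]
      ext x
      simp only [inner_eLast, Set.mem_ofPred_eq, Set.mem_inter_iff, halfSpace]
      exact ⟨fun h => ⟨h, h ▸ ha⟩, fun h => h.1⟩
  · exact ⟨Quadric.sphere c R hR, hs c R hR (by rw [hc, abs_of_pos hR]),
      (Quadric.locus_sphere c R hR).symm⟩
  · have hR : 0 < R := (abs_nonneg _).trans_lt hc
    exact ⟨Quadric.sphere c R hR, hs c R hR hc.le, (Quadric.locus_sphere c R hR).symm⟩
  · refine ⟨Quadric.plane u hu b, ?_, (Quadric.locus_plane u hu b).symm⟩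
    exact (sq_le_one_iff_abs_le_one _).2 hu'.le

/-- The quadrics that are orthogonal to the ideal boundary are generalized hyperspheres. -/
theorem Quadric.isGenHypersphere {Q : Quadric m} (hb : height Q.b = 0) :
    IsGenHypersphere Q.locus := by
  right
  by_cases ha : Q.a = 0
  · right
    have hn := Q.normalized
    rw [ha, mul_zero, zero_mul, sub_zero, pow_eq_one_iff_of_nonneg (norm_nonneg _) two_ne_zero] at hn
    refine ⟨Q.b, -Q.d, hn, by simp [hb], ?_⟩
    rw [← Quadric.locus_plane _ hn]
    ext x
    simp [locus, eval, plane, ha]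
  · left
    refine ⟨(-(2 * Q.a)⁻¹) • Q.b, |2 * Q.a|⁻¹, ?_, ?_⟩
    · rw [height_smul, hb, mul_zero, abs_zero]; positivity
    · ext x
      have h0 : (0 : ℝ) ≤ |2 * Q.a|⁻¹ := by positivity
      have h1 : 4 * Q.a ^ 2 * (‖x - (-(2 * Q.a)⁻¹) • Q.b‖ ^ 2 - (|2 * Q.a|⁻¹) ^ 2) =
          4 * Q.a * Q.eval x := by
        rw [norm_sub_sq_real, norm_smul, inner_smul_right, mul_pow, Real.norm_eq_abs, sq_abs,
          inv_pow, sq_abs, eval, real_inner_comm]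
        field_simp
        linear_combination Q.normalized
      rw [Set.mem_inter_iff, mem_sphere_iff_norm, ← pow_left_inj₀ (norm_nonneg _) h0 two_ne_zero,
        ← sub_eq_zero, and_comm]
      have : Q.eval x = 0 ↔ ‖x - (-(2 * Q.a)⁻¹) • Q.b‖ ^ 2 - (|2 * Q.a|⁻¹) ^ 2 = 0 := by
        constructor
        · intro h
          rw [h, mul_zero] at h1
          exact (mul_eq_zero.1 h1).resolve_left (by positivity)
        · intro h
          rw [h, mul_zero] at h1
          exact (mul_eq_zero.1 h1.symm).resolve_left (by simpa using ha)
      rw [← this]; rfl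

/-! ### Involutive isometries of the half-space model -/

/-- An involutive hyperbolic isometry that is conformal and maps quadrics to quadrics. -/
structure IsConformalInvolution (Φ : E m → E m) : Prop where
  mapsTo : ∀ x ∈ halfSpace m, Φ x ∈ halfSpace m
  invol : ∀ x ∈ halfSpace m, Φ (Φ x) = x
  contDiffOn : ContDiffOn ℝ ∞ Φ (halfSpace m)
  hypDist_eq : ∀ x ∈ halfSpace m, ∀ y ∈ halfSpace m, hypDist (Φ x) (Φ y) = hypDist x y
  exists_quadric : ∀ Q : Quadric m, ∃ Q' : Quadric m, height Q'.b = height Q.b ∧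
    ∀ x ∈ halfSpace m, (Q.eval (Φ x) = 0 ↔ Q'.eval x = 0) ∧
      (Q'.eval x = 0 → ∃ (k : ℝ) (A : E m ≃ₗᵢ[ℝ] E m), 0 < k ∧
        HasFDerivAt Φ (k • (A : E m →L[ℝ] E m)) x ∧ Q.grad (Φ x) = A (Q'.grad x))

theorem IsConformalInvolution.isHypIsometry {Φ : E m → E m} (h : IsConformalInvolution Φ) :
    IsHypIsometry Φ :=
  ⟨Set.BijOn.mk h.mapsTo (fun x hx y hy hxy => by rw [← h.invol x hx, hxy, h.invol y hy])
    fun x hx => ⟨Φ x, h.mapsTo x hx, h.invol x hx⟩, h.hypDist_eq⟩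

theorem isConformalInvolution_id : IsConformalInvolution (id : E m → E m) where
  mapsTo := fun _ h => h
  invol := fun _ _ => rfl
  contDiffOn := contDiff_id.contDiffOn
  hypDist_eq := fun _ _ _ _ => rfl
  exists_quadric := fun Q => ⟨Q, rfl, fun x _ => ⟨Iff.rfl, fun _ =>
    ⟨1, LinearIsometryEquiv.refl ℝ _, one_pos, by
      rw [one_smul]; exact hasFDerivAt_id x, rfl⟩⟩⟩

/-- In this form the invariance under inversions is visible: `‖x - y‖²` and the product of the
heights are scaled by the same factor. -/
theorem hypDist_eq_norm (x y : E m) : hypDist x y = 2 * Real.artanh (Real.sqrt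
    (‖x - y‖ ^ 2 / (‖x - y‖ ^ 2 + 4 * height x * height y))) := by
  have h : ‖x - y‖ ^ 2 =
      (∑ i : Fin m, (x i.castSucc - y i.castSucc) ^ 2) + (height x - height y) ^ 2 := by
    rw [EuclideanSpace.norm_sq_eq, Fin.sum_univ_castSucc]
    simp [height]
  rw [hypDist, h]
  congr 4
  ring

/-! ### Inversions centred on the ideal boundary. -/

variable {q : E m} {r : ℝ}

theorem ne_of_mem_halfSpace (hq : height q = 0) {x : E m} (hx : x ∈ halfSpace m) : x ≠ q := by
  rintro rfl
  exact (ne_of_gt hx) hq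

theorem inversion_eq (x : E m) : inversion q r x = q + (r ^ 2 / ‖x - q‖ ^ 2) • (x - q) := by
  rw [inversion, vsub_eq_sub, vadd_eq_add, add_comm, dist_eq_norm, div_pow]

theorem height_inversion (hq : height q = 0) (x : E m) :
    height (inversion q r x) = r ^ 2 / ‖x - q‖ ^ 2 * height x := by
  rw [inversion_eq, height_add, height_smul, height_sub, hq, zero_add, sub_zero]

/-- The image of a quadric under the inversion with centre `q` and radius `r`. -/
def Quadric.invert (Q : Quadric m) (q : E m) (r : ℝ) (hr : r ≠ 0) : Quadric m where
  a := Q.eval q / r ^ 2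
  b := Q.grad q - (2 * (Q.eval q / r ^ 2)) • q
  d := Q.a * r ^ 2 + Q.eval q / r ^ 2 * ‖q‖ ^ 2 - inner ℝ (Q.grad q) q
  normalized := by
    have h := Q.norm_grad_sq q
    rw [norm_sub_sq_real, norm_smul, inner_smul_right, mul_pow, Real.norm_eq_abs, sq_abs]
    field_simp
    linear_combination r ^ 4 * h

theorem Quadric.eval_invert (Q : Quadric m) (hr : r ≠ 0) (x : E m) :
    (Q.invert q r hr).eval x =
      Q.a * r ^ 2 + inner ℝ (Q.grad q) (x - q) + Q.eval q / r ^ 2 * ‖x - q‖ ^ 2 := by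
  simp only [eval, invert, norm_sub_sq_real, inner_sub_left, inner_sub_right, inner_smul_left,
    conj_trivial, real_inner_comm x q]
  ring

/-- In the Taylor expansion of `Q` at the centre `q`, the inversion exchanges the terms of degree
zero and two, up to powers of `r` and a common factor. -/
theorem Quadric.eval_inversion (Q : Quadric m) (hr : r ≠ 0) {x : E m} (hx : x ≠ q) :
    Q.eval (inversion q r x) = r ^ 2 / ‖x - q‖ ^ 2 * (Q.invert q r hr).eval x := by
  have h : ‖x - q‖ ≠ 0 := norm_ne_zero_iff.2 (sub_ne_zero.2 hx)
  rw [eval_invert, inversion_eq, eval_add, inner_smul_right, norm_smul, mul_pow, Real.norm_eq_abs,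
    sq_abs]
  field_simp
  ring

theorem isConformalInvolution_inversion (hq : height q = 0) (hr : r ≠ 0) :
    IsConformalInvolution (inversion q r) where
  mapsTo x hx := by
    have h : ‖x - q‖ ≠ 0 := norm_ne_zero_iff.2 (sub_ne_zero.2 (ne_of_mem_halfSpace hq hx))
    have hx' : 0 < height x := hx
    change 0 < height _
    rw [height_inversion hq]
    positivity
  invol x _ := inversion_inversion q hr x
  contDiffOn := contDiffOn_const.inversion contDiffOn_const contDiffOn_id
    fun x hx => ne_of_mem_halfSpace hq hx
  hypDist_eq x hx y hy := by
    have hx' := ne_of_mem_halfSpace hq hx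
    have hy' := ne_of_mem_halfSpace hq hy
    have h1 : ‖x - q‖ ≠ 0 := norm_ne_zero_iff.2 (sub_ne_zero.2 hx')
    have h2 : ‖y - q‖ ≠ 0 := norm_ne_zero_iff.2 (sub_ne_zero.2 hy')
    have h3 := dist_inversion_inversion hx' hy' r
    rw [dist_eq_norm, dist_eq_norm, dist_eq_norm, dist_eq_norm] at h3
    rw [hypDist_eq_norm, hypDist_eq_norm, h3, height_inversion hq, height_inversion hq]
    congr 3
    rw [show (r ^ 2 / (‖x - q‖ * ‖y - q‖) * ‖x - y‖) ^ 2 =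
        (r ^ 2 / (‖x - q‖ * ‖y - q‖)) ^ 2 * ‖x - y‖ ^ 2 by ring,
      show (r ^ 2 / (‖x - q‖ * ‖y - q‖)) ^ 2 * ‖x - y‖ ^ 2 +
        4 * (r ^ 2 / ‖x - q‖ ^ 2 * height x) * (r ^ 2 / ‖y - q‖ ^ 2 * height y) =
        (r ^ 2 / (‖x - q‖ * ‖y - q‖)) ^ 2 * (‖x - y‖ ^ 2 + 4 * height x * height y) by
          field_simp]
    exact mul_div_mul_left _ _ (by positivity)
  exists_quadric Q := by
    refine ⟨Q.invert q r hr, ?_, fun x hx => ?_⟩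
    -- The new `b` differs from the old one by a multiple of `q`, which has height zero.
    · simp only [Quadric.invert, Quadric.grad, height_sub, height_add, height_smul, hq]
      ring
    have hx' := ne_of_mem_halfSpace hq hx
    have h1 : ‖x - q‖ ≠ 0 := norm_ne_zero_iff.2 (sub_ne_zero.2 hx')
    refine ⟨?_, fun h => ?_⟩
    · rw [Q.eval_inversion hr hx', mul_eq_zero]
      exact or_iff_right (by positivity)
    refine ⟨(r / dist x q) ^ 2, (ℝ ∙ (x - q))ᗮ.reflection, ?_, hasFDerivAt_inversion hx', ?_⟩
    · rw [dist_eq_norm]; positivity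
    · have h2 : (Q.invert q r hr).grad x = Q.grad q + (2 * (Q.eval q / r ^ 2)) • (x - q) := by
        simp only [Quadric.grad, Quadric.invert]; module
      have h3 : Q.grad (inversion q r x) = Q.grad q + (2 * Q.a * (r ^ 2 / ‖x - q‖ ^ 2)) • (x - q) := by
        rw [inversion_eq]
        simp only [Quadric.grad]; module
      rw [Quadric.eval_invert] at h
      rw [h2, h3, Submodule.reflection_orthogonal_apply, Submodule.reflection_singleton_apply,
        inner_add_right, inner_smul_right, real_inner_self_eq_norm_sq, real_inner_comm]
      have h4 : (inner ℝ (Q.grad q) (x - q) : ℝ) =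
          -(Q.a * r ^ 2) - Q.eval q / r ^ 2 * ‖x - q‖ ^ 2 := by linarith
      rw [h4]
      generalize x - q = z at h1
      match_scalars
      · norm_num
      · simp only [RCLike.ofReal_real_eq_id, id_eq]
        field_simp
        ring

/-! ### Normal form of a horocycle -/

theorem eq_add_smul_of_deriv_eq {F : Type*} [NormedAddCommGroup F] [NormedSpace ℝ F]
    {y y' : ℝ → F} (h1 : ∀ t, HasDerivAt y (y' t) t) (h2 : ∀ t, HasDerivAt y' 0 t) (t : ℝ) :
    y t = y 0 + t • y' 0 := by
  have hc : ∀ s, y' s = y' 0 := fun s =>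
    is_const_of_deriv_eq_zero (fun u => (h2 u).differentiableAt) (fun u => (h2 u).deriv) s 0
  have h3 : ∀ s, HasDerivAt (fun s => y s - s • y' 0) 0 s := by
    intro s
    have := (h1 s).fun_sub ((hasDerivAt_id s).smul_const (y' 0))
    simpa [hc s] using this
  have h4 := is_const_of_deriv_eq_zero (fun u => (h3 u).differentiableAt) (fun u => (h3 u).deriv) t 0
  simp only [zero_smul, sub_zero] at h4
  rw [← h4]; abel

/-- The geodesic equation in a horizontal hyperplane. -/
theorem exists_line_of_height_eq {γ : ℝ → E m} {a : ℝ} (hγ : ContDiff ℝ 2 γ)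
    (h : ∀ t : ℝ, height (γ t) = a)
    (hacc : ∀ t, ∃ k : ℝ, hypAccel γ t = k • eLast m) :
    height (deriv γ 0) = 0 ∧ ∀ t, γ t = γ 0 + t • deriv γ 0 := by
  have d1 : ∀ t, HasDerivAt γ (deriv γ t) t := fun t =>
    (hγ.differentiable (by simp) t).hasDerivAt
  have d2 : ∀ t, HasDerivAt (deriv γ) (deriv (deriv γ) t) t := fun t =>
    ((hγ.iterate_deriv' 1 1).differentiable (by simp) t).hasDerivAt
  have h1 : ∀ t, height (deriv γ t) = 0 := fun t =>
    (d1 t).height.unique (by simpa only [h] using hasDerivAt_const t a)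
  have h2 : ∀ t, height (deriv (deriv γ) t) = 0 := fun t =>
    (d2 t).height.unique (by simpa only [h1] using hasDerivAt_const t (0 : ℝ))
  have h3 : ∀ t, deriv (deriv γ) t = 0 := by
    intro t
    obtain ⟨k, hk⟩ := hacc t
    -- As the velocity is horizontal, the Christoffel term is vertical. So `γ''` is vertical as well
    -- as horizontal.
    obtain ⟨l, hl⟩ : ∃ l : ℝ, deriv (deriv γ) t = l • eLast m := by
      refine ⟨k - (height (γ t))⁻¹ * inner ℝ (deriv γ t) (deriv γ t), ?_⟩
      rw [hypAccel, christoffel, h1 t] at hk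
      rw [sub_smul, ← hk]
      module
    have := h2 t
    rw [hl, height_smul, height_eLast, mul_one] at this
    rw [hl, this, zero_smul]
  exact ⟨h1 0, eq_add_smul_of_deriv_eq d1 fun t => by simpa only [h3] using d2 t⟩

/-- The geodesic equation in the sphere with centre `q + R e` and radius `R`. -/
theorem exists_line_of_mem_sphere {γ : ℝ → E m} {q : E m} {R : ℝ} (hR : 0 < R)
    (hq : height q = 0) (hγ : ContDiff ℝ 2 γ) (hpos : ∀ t, 0 < height (γ t))
    (h : ∀ t : ℝ, ‖γ t - q‖ ^ 2 = 2 * R * height (γ t))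
    (hunit : ∀ t, ‖deriv γ t‖ ^ 2 = height (γ t) ^ 2)
    (hacc : ∀ t, ∃ k : ℝ, hypAccel γ t = k • (γ t - q - R • eLast m)) :
    ∃ p w : E m, height p = 1 ∧ height w = 0 ∧
      ∀ t, (height (γ t))⁻¹ • (γ t - q) = p + t • w := by
  have d1 : ∀ t, HasDerivAt γ (deriv γ t) t := fun t =>
    (hγ.differentiable (by simp) t).hasDerivAt
  have d2 : ∀ t, HasDerivAt (deriv γ) (deriv (deriv γ) t) t := fun t =>
    ((hγ.iterate_deriv' 1 1).differentiable (by simp) t).hasDerivAt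
  have hne : ∀ t, height (γ t) ≠ 0 := fun t => (hpos t).ne'
  have dz : ∀ t, HasDerivAt (fun t => γ t - q) (deriv γ t) t := fun t => (d1 t).sub_const q
  have i1 : ∀ t, inner ℝ (γ t - q) (deriv γ t) = R * height (deriv γ t) := by
    intro t
    have e1 := (dz t).norm_sq
    simp only [h] at e1
    have e2 := e1.unique ((d1 t).height.const_mul (2 * R))
    linarith
  have i2 : ∀ t, inner ℝ (γ t - q) (deriv (deriv γ) t) =
      R * height (deriv (deriv γ) t) - height (γ t) ^ 2 := by
    intro t
    have e1 := (dz t).inner ℝ (d2 t)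
    simp only [i1, real_inner_self_eq_norm_sq, hunit] at e1
    have e2 := e1.unique ((d2 t).height.const_mul R)
    linarith
  have dinv : ∀ t, HasDerivAt (fun t => (height (γ t))⁻¹)
      (-height (deriv γ t) / height (γ t) ^ 2) t := fun t => (d1 t).height.fun_inv (hne t)
  -- This is the velocity of `(γ - q) / height γ`, which by the equation of the sphere is the image
  -- of `γ` under the inversion at `q` of squared radius `2R`, seen from `q`.
  set y' : ℝ → E m := fun t => (height (γ t))⁻¹ • deriv γ t +
    (-height (deriv γ t) / height (γ t) ^ 2) • (γ t - q) with hy'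
  have dy : ∀ t, HasDerivAt (fun t => (height (γ t))⁻¹ • (γ t - q)) (y' t) t := fun t =>
    (dinv t).fun_smul (dz t)
  have hyy : ∀ t, height ((height (γ t))⁻¹ • (γ t - q)) = 1 := by
    intro t
    rw [height_smul, height_sub, hq, sub_zero, inv_mul_cancel₀ (hne t)]
  have hy0 : ∀ t, height (y' t) = 0 := fun t =>
    (dy t).height.unique (by simpa only [hyy] using hasDerivAt_const t (1 : ℝ))
  have dy' : ∀ t, HasDerivAt y' 0 t := by
    intro t
    obtain ⟨k, hk⟩ := hacc t
    have e0 := ((dinv t).fun_smul (d2 t)).fun_add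
      ((((d2 t).height.fun_neg).fun_div ((d1 t).height.fun_pow 2) (pow_ne_zero 2 (hne t))).fun_smul
        (dz t))
    have e3 : deriv (deriv γ) t = (2 * height (deriv γ t) / height (γ t)) • deriv γ t +
        (-(height (γ t)) - k * R) • eLast m + k • (γ t - q) := by
      rw [hypAccel, christoffel, real_inner_self_eq_norm_sq, hunit, ← eq_sub_iff_add_eq] at hk
      rw [hk]
      have := hne t
      generalize γ t - q = z
      match_scalars <;> field_simp <;> ring
    -- The multiplier `k` is found by comparing the acceleration with the sphere equation
    -- differentiated twice, which is `i2`.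
    have hk' : k * R = -height (γ t) := by
      have e4 := i2 t
      rw [e3] at e4
      simp only [inner_add_right, inner_smul_right, i1, real_inner_self_eq_norm_sq, h,
        inner_eLast_right, height_add, height_smul, height_sub, hq, height_eLast] at e4
      have e5 : R * (k * R + height (γ t)) = 0 := by
        linear_combination e4
      have := (mul_eq_zero.1 e5).resolve_left hR.ne'
      linarith
    rw [hk', sub_neg_eq_add, neg_add_cancel, zero_smul, add_zero] at e3
    -- The value of `l` need not be computed: `γ t - q` has positive height, whereas `y'` is
    -- horizontal, so `l = 0`.
    obtain ⟨l, hl⟩ : ∃ l : ℝ, HasDerivAt y' (l • (γ t - q)) t := by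
      have alg : ∀ C : ℝ, (height (γ t))⁻¹ • deriv (deriv γ) t +
          (-height (deriv γ t) / height (γ t) ^ 2) • deriv γ t +
          ((-height (deriv γ t) / height (γ t) ^ 2) • deriv γ t + C • (γ t - q)) =
          ((height (γ t))⁻¹ * k + C) • (γ t - q) := by
        intro C
        have := hne t
        generalize height (deriv γ t) = u at *
        rw [e3]
        generalize γ t - q = z
        match_scalars <;> field_simp
        ring
      exact ⟨_, e0.congr_deriv (alg _)⟩
    have e6 := hl.height.unique (by simpa only [hy0] using hasDerivAt_const t (0 : ℝ))
    rw [height_smul, height_sub, hq, sub_zero] at e6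
    rwa [(mul_eq_zero.1 e6).resolve_right (hne t), zero_smul] at hl
  refine ⟨_, y' 0, hyy 0, hy0 0, eq_add_smul_of_deriv_eq dy dy'⟩

theorem IsHorocycle.exists_normalForm {γ : ℝ → E m} (hγ : IsHorocycle γ) :
    ∃ (Φ : E m → E m) (p w : E m), IsConformalInvolution Φ ∧ p ∈ halfSpace m ∧ w ≠ 0 ∧
      height w = 0 ∧ ∀ t : ℝ, γ t = Φ (p + t • w) := by
  obtain ⟨S, hS, hsmooth, h⟩ := hγ
  have hpos : ∀ t, 0 < height (γ t) := by
    intro t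
    obtain ⟨U, f, hf, -⟩ := (h t).2.2
    exact hf.subset hf.mem
  have hunit : ∀ t, ‖deriv γ t‖ ^ 2 = height (γ t) ^ 2 := by
    intro t
    have := (h t).2.1
    rwa [hypMetric, div_eq_one_iff_eq (pow_ne_zero 2 (hpos t).ne'),
      real_inner_self_eq_norm_sq] at this
  have hne : deriv γ 0 ≠ 0 := by
    intro h0
    have := hunit 0
    rw [h0, norm_zero] at this
    exact (pow_pos (hpos 0) 2).ne (by simpa using this)
  rcases hS with ⟨a, ha, rfl⟩ | ⟨c, R, hR, hc, rfl⟩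
  · have hS : {x : E m | height x = a} = (Quadric.plane (eLast m) norm_eLast a).locus := by
      rw [Quadric.locus_plane]
      ext x
      simp only [inner_eLast, Set.mem_ofPred_eq, Set.mem_inter_iff, halfSpace]
      exact ⟨fun h => ⟨h, h ▸ ha⟩, fun h => h.1⟩
    obtain ⟨h1, h2⟩ := exists_line_of_height_eq hsmooth (fun t => (h t).1) fun t => by
      have h3 := (h t).2.2
      rw [hS] at h3
      have h4 := Quadric.isNormalTo h3
      rw [show (Quadric.plane (eLast m) norm_eLast a).grad (γ t) = eLast m by
        simp [Quadric.grad, Quadric.plane]] at h4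
      exact ⟨_, h4⟩
    exact ⟨id, γ 0, deriv γ 0, isConformalInvolution_id, hpos 0, hne, h1, h2⟩
  · rw [← Quadric.locus_sphere c R hR] at h
    -- The point of tangency.
    set q : E m := c - R • eLast m with hq
    have hq0 : height q = 0 := by
      rw [hq, height_sub, height_smul, height_eLast, hc, mul_one, sub_self]
    have hz : ∀ x, x - c = x - q - R • eLast m := fun x => by rw [hq]; abel
    have hsph : ∀ t, ‖γ t - q‖ ^ 2 = 2 * R * height (γ t) := by
      intro t
      have h1 := (h t).1
      rw [Quadric.locus_sphere] at h1
      have h2 := mem_sphere_iff_norm.1 h1.1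
      rw [hz] at h2
      have h3 := norm_sub_sq_real (γ t - q) (R • eLast m)
      rw [h2, inner_smul_right, inner_eLast_right, norm_smul, norm_eLast, mul_one, height_sub, hq0,
        Real.norm_eq_abs, sq_abs] at h3
      linarith
    obtain ⟨p, w, hp, hw, hl⟩ := exists_line_of_mem_sphere hR hq0 hsmooth hpos hsph hunit fun t => by
      have h4 := Quadric.isNormalTo (h t).2.2
      rw [Quadric.grad_sphere, smul_smul, hz] at h4
      exact ⟨_, h4⟩
    -- For this radius the inversion sends the horosphere to the hyperplane at height one.
    have hr : Real.sqrt (2 * R) ≠ 0 := (Real.sqrt_pos.2 (by positivity)).ne'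
    have hγ : ∀ t, γ t = inversion q (Real.sqrt (2 * R)) (q + p + t • w) := by
      intro t
      rw [← inversion_inversion q hr (γ t), inversion_eq (γ t), hsph t,
        Real.sq_sqrt (by positivity), add_assoc, ← hl t]
      have := (hpos t).ne'
      congr 3
      field_simp
    refine ⟨_, q + p, w, isConformalInvolution_inversion hq0 hr, ?_, ?_, hw, hγ⟩
    · change 0 < height _
      rw [height_add, hq0, hp]; norm_num
    · rintro rfl
      apply hne
      have : γ = fun _ => inversion q (Real.sqrt (2 * R)) (q + p) := by
        funext t; rw [hγ t, smul_zero, add_zero]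
      rw [this, deriv_const]

/-! ### The foliation by the images of parallel vertical hyperplanes -/

/-- The diffeomorphism of the whole space onto the half-space that exponentiates the height. -/
def expHeight (y : E m) : E m := y + (Real.exp (height y) - height y) • eLast m

/-- The inverse of `expHeight` on the half-space. -/
def logHeight (x : E m) : E m := x + (Real.log (height x) - height x) • eLast m

theorem height_expHeight (y : E m) : height (expHeight y) = Real.exp (height y) := by
  rw [expHeight, height_add, height_smul, height_eLast]; ring

theorem height_logHeight (x : E m) : height (logHeight x) = Real.log (height x) := by
  rw [logHeight, height_add, height_smul, height_eLast]; ring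

theorem expHeight_mem (y : E m) : expHeight y ∈ halfSpace m := by
  change 0 < height _
  rw [height_expHeight]; exact Real.exp_pos _

theorem logHeight_expHeight (y : E m) : logHeight (expHeight y) = y := by
  rw [logHeight, height_expHeight, Real.log_exp, expHeight]; module

theorem expHeight_logHeight {x : E m} (hx : x ∈ halfSpace m) : expHeight (logHeight x) = x := by
  rw [expHeight, height_logHeight, Real.exp_log hx, logHeight]; module

theorem contDiff_expHeight : ContDiff ℝ ∞ (expHeight : E m → E m) :=
  contDiff_id.add (((Real.contDiff_exp.comp contDiff_height).sub contDiff_height).smul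
    contDiff_const)

theorem contDiffOn_logHeight : ContDiffOn ℝ ∞ (logHeight : E m → E m) (halfSpace m) :=
  contDiffOn_id.add (((contDiff_height.contDiffOn.log fun _ hx => ne_of_gt hx).sub
    contDiff_height.contDiffOn).smul contDiffOn_const)

/-- Rescaling the height is invisible to horizontal linear forms, so vertical hyperplanes remain
level sets in the global chart. -/
theorem inner_logHeight {u : E m} (hu : height u = 0) (x : E m) :
    (inner ℝ u (logHeight x) : ℝ) = inner ℝ u x := by
  rw [logHeight, inner_add_right, inner_smul_right, inner_eLast_right, hu, mul_zero, add_zero]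

/-- Linear coordinates the last one of which is a given nonzero linear form. -/
theorem exists_coordinates {u : E m} (hu : u ≠ 0) :
    ∃ C : (EuclideanSpace ℝ (Fin m) × ℝ) ≃L[ℝ] E m, ∀ y : E m, (C.symm y).2 = inner ℝ u y := by
  have : Fact (Module.finrank ℝ (E m) = m + 1) := ⟨by simp⟩
  let B := OrthonormalBasis.fromOrthogonalSpanSingleton (𝕜 := ℝ) m hu
  let T : E m →ₗ[ℝ] EuclideanSpace ℝ (Fin m) × ℝ :=
    (B.repr.toLinearEquiv.toLinearMap ∘ₗ
      (ℝ ∙ u)ᗮ.orthogonalProjectionOnto.toLinearMap).prod (innerSL ℝ u).toLinearMap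
  have hT : Function.Injective T := by
    rw [injective_iff_map_eq_zero]
    intro y hy
    have h1 : (ℝ ∙ u)ᗮ.orthogonalProjectionOnto y = 0 :=
      B.repr.toLinearEquiv.injective ((Prod.ext_iff.1 hy).1.trans (map_zero _).symm)
    have h2 : (inner ℝ u y : ℝ) = 0 := (Prod.ext_iff.1 hy).2
    have h3 : y ∈ (ℝ ∙ u)ᗮ := Submodule.mem_orthogonal_singleton_iff_inner_right.2 h2
    have h4 := Submodule.orthogonalProjectionOnto_mem_subspace_eq_self (⟨y, h3⟩ : (ℝ ∙ u)ᗮ)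
    rw [h1] at h4
    exact (congrArg Subtype.val h4).symm
  let T' := LinearMap.linearEquivOfInjective T hT (by simp)
  exact ⟨T'.symm.toContinuousLinearEquiv, fun y => rfl⟩

/-- The derivatives along a slice are the full derivatives of `G` restricted to the first factor. -/
theorem continuous_iteratedFDeriv_prodMk {X Y F : Type*} [NormedAddCommGroup X] [NormedSpace ℝ X]
    [NormedAddCommGroup Y] [NormedSpace ℝ Y] [NormedAddCommGroup F] [NormedSpace ℝ F]
    {G : X × Y → F} (hG : ContDiff ℝ ∞ G) (k : ℕ) :
    Continuous fun q : X × Y => iteratedFDeriv ℝ k (fun x => G (x, q.2)) q.1 := by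
  have h : ∀ q : X × Y, iteratedFDeriv ℝ k (fun x => G (x, q.2)) q.1 =
      (iteratedFDeriv ℝ k G q).compContinuousLinearMap
        fun _ => ContinuousLinearMap.inl ℝ X Y := by
    intro q
    have h1 : (fun x => G (x, q.2)) =
        (fun z => G (z + (0, q.2))) ∘ ContinuousLinearMap.inl ℝ X Y := by
      funext x; simp
    have h2 : ContDiff ℝ ∞ fun z => G (z + (0, q.2)) := hG.comp (contDiff_id.add contDiff_const)
    rw [h1, ContinuousLinearMap.iteratedFDeriv_comp_right _ h2 _ (by exact_mod_cast le_top),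
      iteratedFDeriv_comp_add_right]
    simp
  simp only [h]
  exact (ContinuousMultilinearMap.compContinuousLinearMapL
    (fun _ => ContinuousLinearMap.inl ℝ X Y)).continuous.comp
      (hG.continuous_iteratedFDeriv (by exact_mod_cast le_top))

variable {Φ : E m → E m} {u : E m}

/-- The global foliated chart. -/
def verticalChart (hΦ : IsConformalInvolution Φ)
    (C : (EuclideanSpace ℝ (Fin m) × ℝ) ≃L[ℝ] E m) :
    OpenPartialHomeomorph (E m) (EuclideanSpace ℝ (Fin m) × ℝ) where
  toFun p := C.symm (logHeight (Φ p))
  invFun z := Φ (expHeight (C z))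
  source := halfSpace m
  target := Set.univ
  map_source' _ _ := Set.mem_univ _
  map_target' _ _ := hΦ.mapsTo _ (expHeight_mem _)
  left_inv' p hp := by
    rw [C.apply_symm_apply, expHeight_logHeight (hΦ.mapsTo p hp), hΦ.invol p hp]
  right_inv' z _ := by
    rw [hΦ.invol _ (expHeight_mem _), logHeight_expHeight, C.symm_apply_apply]
  open_source := isOpen_halfSpace
  open_target := isOpen_univ
  continuousOn_toFun := C.symm.continuous.comp_continuousOn
    (contDiffOn_logHeight.continuousOn.comp hΦ.contDiffOn.continuousOn hΦ.mapsTo)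
  continuousOn_invFun := (hΦ.contDiffOn.continuousOn.comp_continuous
    (contDiff_expHeight.continuous.comp C.continuous) fun _ => expHeight_mem _).continuousOn

theorem contDiff_verticalChart_symm (hΦ : IsConformalInvolution Φ)
    (C : (EuclideanSpace ℝ (Fin m) × ℝ) ≃L[ℝ] E m) : ContDiff ℝ ∞ (verticalChart hΦ C).symm :=
  hΦ.contDiffOn.comp_contDiff (contDiff_expHeight.comp C.contDiff) fun _ => expHeight_mem _

theorem contDiffOn_verticalChart (hΦ : IsConformalInvolution Φ)
    (C : (EuclideanSpace ℝ (Fin m) × ℝ) ≃L[ℝ] E m) :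
    ContDiffOn ℝ ∞ (verticalChart hΦ C) (halfSpace m) :=
  C.symm.contDiff.comp_contDiffOn (contDiffOn_logHeight.comp hΦ.contDiffOn hΦ.mapsTo)

theorem verticalChart_snd (hΦ : IsConformalInvolution Φ)
    {C : (EuclideanSpace ℝ (Fin m) × ℝ) ≃L[ℝ] E m} (hC : ∀ y : E m, (C.symm y).2 = inner ℝ u y)
    (hu : height u = 0) (p : E m) : (verticalChart hΦ C p).2 = inner ℝ u (Φ p) := by
  rw [← inner_logHeight hu, ← hC]; rfl

/-- The foliation by the images under `Φ` of a family of parallel hyperplanes. -/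
def verticalFoliation (hΦ : IsConformalInvolution Φ)
    (C : (EuclideanSpace ℝ (Fin m) × ℝ) ≃L[ℝ] E m) : Foliation m where
  charts := {verticalChart hΦ C}
  source_subset := by rintro _ rfl; exact subset_rfl
  target_eq := by rintro _ rfl; rfl
  cover p hp := ⟨_, rfl, hp⟩
  plaque_smooth := by
    rintro _ rfl s
    exact (contDiff_verticalChart_symm hΦ C).comp (contDiff_id.prodMk contDiff_const)
  plaque_immersed := by
    rintro _ rfl x s
    set φ := verticalChart hΦ C
    have h1 : HasFDerivAt (fun y : EuclideanSpace ℝ (Fin m) => φ.symm (y, s))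
        (fderiv ℝ (fun y : EuclideanSpace ℝ (Fin m) => φ.symm (y, s)) x) x :=
      (((contDiff_verticalChart_symm hΦ C).comp
        (contDiff_id.prodMk contDiff_const)).differentiable (by simp) x).hasFDerivAt
    have h2 : DifferentiableAt ℝ φ (φ.symm (x, s)) :=
      ((contDiffOn_verticalChart hΦ C).contDiffAt (isOpen_halfSpace.mem_nhds
        (φ.map_target (Set.mem_univ _)))).differentiableAt (by simp)
    -- By the chain rule, the derivative of the chart is a left inverse up to the inclusion `y ↦ (y,
    -- 0)`, which is injective.
    have h3 := h2.hasFDerivAt.comp x h1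
    have h4 : (φ ∘ fun y : EuclideanSpace ℝ (Fin m) => φ.symm (y, s)) = fun y => (y, s) :=
      funext fun y => φ.right_inv (Set.mem_univ _)
    rw [h4] at h3
    have h5 := h3.unique (hasFDerivAt_prodMk_left x s)
    intro v w hvw
    have h6 := DFunLike.congr_fun h5 v
    have h7 := DFunLike.congr_fun h5 w
    simp only [ContinuousLinearMap.comp_apply] at h6 h7
    rw [hvw, h7] at h6
    exact (Prod.ext_iff.1 h6).1.symm
  plaque_continuous := by
    rintro _ rfl k
    exact continuous_iteratedFDeriv_prodMk (contDiff_verticalChart_symm hΦ C) k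
  compatible := by
    rintro _ rfl _ rfl x hx
    exact ⟨halfSpace m, isOpen_halfSpace, hx.1, fun y hy => ⟨hy, hy⟩, fun _ _ _ _ => Iff.rfl⟩

theorem plaque_verticalChart (hΦ : IsConformalInvolution Φ)
    {C : (EuclideanSpace ℝ (Fin m) × ℝ) ≃L[ℝ] E m} (hC : ∀ y : E m, (C.symm y).2 = inner ℝ u y)
    (hu : height u = 0) (p : E m) : plaque (verticalChart hΦ C) p =
      {x ∈ halfSpace m | (inner ℝ u (Φ x) : ℝ) = inner ℝ u (Φ p)} := by
  simp only [plaque, verticalChart_snd hΦ hC hu]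
  rfl

theorem leaf_verticalFoliation (hΦ : IsConformalInvolution Φ)
    {C : (EuclideanSpace ℝ (Fin m) × ℝ) ≃L[ℝ] E m} (hC : ∀ y : E m, (C.symm y).2 = inner ℝ u y)
    (hu : height u = 0) {p : E m} (hp : p ∈ halfSpace m) : (verticalFoliation hΦ C).leaf p =
      {x ∈ halfSpace m | (inner ℝ u (Φ x) : ℝ) = inner ℝ u (Φ p)} := by
  ext x
  constructor
  · intro hx
    induction hx with
    | refl => exact ⟨hp, rfl⟩
    | tail _ h ih =>
      obtain ⟨_, rfl, -, h⟩ := h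
      rw [plaque_verticalChart hΦ hC hu] at h
      exact ⟨h.1, h.2.trans ih.2⟩
  · intro hx
    refine Relation.ReflTransGen.single ⟨_, rfl, hp, ?_⟩
    rwa [plaque_verticalChart hΦ hC hu]

/-- Any two leaves of a foliation are equal or disjoint. -/
theorem Foliation.leaf_eq_of_mem (F : Foliation m) {p q x : E m} (hp : x ∈ F.leaf p)
    (hq : x ∈ F.leaf q) : F.leaf p = F.leaf q := by
  have hs : Std.Symm F.SamePlaque :=
    ⟨fun _ _ ⟨φ, hφ, ha, hb⟩ => ⟨φ, hφ, hb.1, ha, hb.2.symm⟩⟩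
  have key : ∀ {p q : E m}, x ∈ F.leaf p → x ∈ F.leaf q → F.leaf p ⊆ F.leaf q :=
    fun hp hq _ hy => (Relation.ReflTransGen.trans hq
      (Relation.ReflTransGen.stdSymm.symm _ _ hp)).trans hy
  exact (key hp hq).antisymm (key hq hp)

/-! ### Quadrics orthogonal to a horizontal line -/

namespace Quadric

variable {Q : Quadric m}

/-- A quadric without quadratic term that is orthogonal to the ideal boundary. -/
theorem isVerticalHyperplane (ha : Q.a = 0) (hb : height Q.b = 0) :
    IsVerticalHyperplane Q.locus := by
  have hn := Q.normalized
  rw [ha, mul_zero, zero_mul, sub_zero, pow_eq_one_iff_of_nonneg (norm_nonneg _) two_ne_zero] at hn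
  refine ⟨Q.b, -Q.d, hn, hb, ?_⟩
  rw [← locus_plane _ hn]
  ext x
  simp [locus, eval, plane, ha]

/-- The expansion at the foot point is exact. With `y` vertical it describes the trace in the
half-plane above the line; with `y = 0` its roots are the points on the line. -/
theorem eval_line {p w y : E m} {c s t : ℝ} (h0 : Q.eval (p + t • w) = 0)
    (h1 : Q.grad (p + t • w) = c • w) (hy : (inner ℝ w y : ℝ) = 0) :
    Q.eval (p + s • w + y) =
      c * (s - t) * ‖w‖ ^ 2 + Q.a * ((s - t) ^ 2 * ‖w‖ ^ 2 + ‖y‖ ^ 2) := by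
  have h2 : p + s • w + y = p + t • w + ((s - t) • w + y) := by module
  rw [h2, eval_add, h0, h1, norm_add_sq_real, norm_smul, mul_pow, Real.norm_eq_abs, sq_abs]
  simp only [inner_add_right, inner_smul_left, inner_smul_right, hy, conj_trivial,
    real_inner_self_eq_norm_sq]
  ring

/-- The quadric meets the line a second time unless it is a hyperplane. -/
theorem a_eq_zero_of_meets_once {p w : E m} {c t : ℝ} (hc : c ≠ 0)
    (h0 : Q.eval (p + t • w) = 0) (h1 : Q.grad (p + t • w) = c • w)
    (h : ∀ s : ℝ, Q.eval (p + s • w) = 0 → s = t) : Q.a = 0 := by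
  by_contra ha
  -- The other root of the quadratic equation along the line.
  have h2 := h (t - c / Q.a) (by
    have := eval_line (s := t - c / Q.a) h0 h1 (inner_zero_right w)
    rw [add_zero] at this
    rw [this, norm_zero]
    field_simp
    ring)
  have h3 : c / Q.a = 0 := by linarith
  exact div_ne_zero hc ha h3

/-- The gradient at the common point is horizontal. Hence vanishing of the quadratic term forces
orthogonality to the ideal boundary. -/
theorem height_b {p w : E m} {c t : ℝ} (hw : height w = 0)
    (h1 : Q.grad (p + t • w) = c • w) : height Q.b = -(2 * Q.a * height p) := by
  have h2 := congrArg height h1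
  rw [grad, height_add, height_smul, height_add, height_smul, height_smul, hw] at h2
  linarith

end Quadric

theorem add_smul_mem_halfSpace {p w : E m} (hp : p ∈ halfSpace m) (hw : height w = 0) (t : ℝ) :
    p + t • w ∈ halfSpace m := by
  change 0 < height _
  rw [height_add, height_smul, hw, mul_zero, add_zero]
  exact hp

/-! ### Orthogonal hypersurfaces and routes when the horocycle is the image of a horizontal line. -/

section NormalForm

variable {Φ : E m → E m} {γ : ℝ → E m} {p w : E m}

theorem hasDerivAt_line (p w : E m) (t : ℝ) : HasDerivAt (fun t : ℝ => p + t • w) w t := by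
  simpa using ((hasDerivAt_id t).smul_const w).const_add p

/-- Orthogonality to `γ` in the coordinates in which `γ` is a line. -/
theorem exists_grad_eq_smul (hΦ : IsConformalInvolution Φ) (hp : p ∈ halfSpace m) (hw0 : w ≠ 0)
    (hw : height w = 0) (hγ : ∀ t : ℝ, γ t = Φ (p + t • w)) (Q : Quadric m) :
    ∃ Q' : Quadric m, height Q'.b = height Q.b ∧
      (∀ x ∈ halfSpace m, Q.eval (Φ x) = 0 ↔ Q'.eval x = 0) ∧
      ∀ t, γ t ∈ Q.locus → IsNormalTo Q.locus (γ t) (deriv γ t) → Q'.eval (p + t • w) = 0 ∧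
        ∃ c : ℝ, c ≠ 0 ∧ Q'.grad (p + t • w) = c • w := by
  obtain ⟨Q', h1, h2⟩ := hΦ.exists_quadric Q
  refine ⟨Q', h1, fun x hx => (h2 x hx).1, fun t ht hn => ?_⟩
  have hl := add_smul_mem_halfSpace hp hw t
  have h3 : Q'.eval (p + t • w) = 0 := ((h2 _ hl).1).1 (hγ t ▸ ht.2)
  obtain ⟨k, A, hk, hA, hg⟩ := (h2 _ hl).2 h3
  have hγ' : γ = Φ ∘ fun t : ℝ => p + t • w := funext hγ
  have h4 : deriv γ t = k • A w := by
    rw [hγ']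
    exact (hA.comp_hasDerivAt t (hasDerivAt_line p w t)).deriv
  have h5 := Quadric.isNormalTo hn
  set μ : ℝ := inner ℝ (Q.grad (γ t)) (deriv γ t)
  rw [h4, hγ t, hg, ← map_smul, ← map_smul] at h5
  -- Conformality: the linear isometry `A` cancels, so orthogonality passes to the line.
  have h6 := A.injective h5
  have hμ : μ ≠ 0 := by
    rintro h
    rw [h, zero_smul] at h6
    exact smul_ne_zero hk.ne' hw0 h6
  refine ⟨h3, k / μ, div_ne_zero hk.ne' hμ, ?_⟩
  rw [div_eq_inv_mul, mul_smul, h6, smul_smul, inv_mul_cancel₀ hμ, one_smul]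

theorem orthogonal_genHypersphere (hΦ : IsConformalInvolution Φ) (hp : p ∈ halfSpace m)
    (hw0 : w ≠ 0) (hw : height w = 0) (hγ : ∀ t : ℝ, γ t = Φ (p + t • w)) {L : Set (E m)}
    (hL : IsGenHypersphere L) (h : MeetsOnceOrthogonally γ L) :
    IsTotallyGeodesic L ∧ IsVerticalHyperplane (Φ '' L) := by
  obtain ⟨Q, -, rfl⟩ := hL.exists_quadric
  obtain ⟨t, ht, hn⟩ := h
  obtain ⟨Q', hb, hQ, h1⟩ := exists_grad_eq_smul hΦ hp hw0 hw hγ Q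
  have htL : γ t ∈ Q.locus := (ht t).2 rfl
  obtain ⟨h2, c, hc, h3⟩ := h1 t htL hn
  have ha : Q'.a = 0 := Quadric.a_eq_zero_of_meets_once hc h2 h3 fun s hs => by
    have hl := add_smul_mem_halfSpace hp hw s
    refine (ht s).1 ⟨hγ s ▸ hΦ.mapsTo _ hl, ?_⟩
    rw [hγ s]
    exact (hQ _ hl).2 hs
  have hb' : height Q'.b = 0 := by rw [Quadric.height_b hw h3, ha]; ring
  refine ⟨Quadric.isTotallyGeodesic ⟨_, htL⟩ (hb ▸ hb'), ?_⟩
  have himage : Φ '' Q.locus = Q'.locus := by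
    ext x
    constructor
    · rintro ⟨y, hy, rfl⟩
      have hy' := hΦ.mapsTo y hy.1
      exact ⟨hy', (hQ _ hy').1 (by rw [hΦ.invol y hy.1]; exact hy.2)⟩
    · intro hx
      exact ⟨Φ x, ⟨hΦ.mapsTo x hx.1, (hQ x hx.1).2 hx.2⟩, hΦ.invol x hx.1⟩
  rw [himage]
  exact Quadric.isVerticalHyperplane ha hb'

/-- A family of half circles centred on a line and of straight lines orthogonal to it, one through
each point of the line, consists of straight lines only if any two members are equal or disjoint
and the diameters are bounded below. -/
theorem eq_zero_of_noncrossing {a c : ℝ → ℝ} {W δ : ℝ} (hW : 0 < W) (hδ : 0 < δ)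
    (hc : ∀ t, c t ≠ 0) (hgap : ∀ t, a t ≠ 0 → δ ≤ |c t / a t|)
    (hcross : ∀ t u s k : ℝ, 0 ≤ k →
      c t * (s - t) * W + a t * ((s - t) ^ 2 * W + k ^ 2) = 0 →
      c u * (s - u) * W + a u * ((s - u) ^ 2 * W + k ^ 2) = 0 →
      c t * (u - t) * W + a t * ((u - t) ^ 2 * W) = 0) (t : ℝ) : a t = 0 := by
  -- The quotient `|c t / a t|` is the diameter, and each passage to the leaf through the centre
  -- more than halves it.
  have key : ∀ (n : ℕ) (t : ℝ), a t ≠ 0 → ¬ |c t / a t| < δ * 2 ^ n := by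
    intro n
    induction n with
    | zero =>
      intro t ht h
      rw [pow_zero, mul_one] at h
      exact absurd (hgap t ht) (not_le.2 h)
    | succ n ih =>
      intro t ht h
      set r : ℝ := c t / a t with hr
      have hr0 : r ≠ 0 := div_ne_zero (hc t) ht
      have hct : c t = r * a t := by rw [hr]; field_simp
      -- The centre of the half circle, whose endpoints are `t` and `t - r`.
      set u : ℝ := t - r / 2 with hu
      have hno : ¬ c t * (u - t) * W + a t * ((u - t) ^ 2 * W) = 0 := by
        have : c t * (u - t) * W + a t * ((u - t) ^ 2 * W) = -(a t * r ^ 2 * W / 4) := by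
          rw [hct, hu]; ring
        rw [this, neg_eq_zero]
        exact (by positivity : a t * r ^ 2 * W / 4 ≠ 0)
      -- Points of the half circle have horizontal offset `x` from `u`, and the height above the
      -- line is then determined. Member `u` avoids all of them, since otherwise member `t` would
      -- contain its own centre.
      have hmeet : ∀ x : ℝ, x ^ 2 ≤ r ^ 2 / 4 →
          c u * x * W + a u * (x ^ 2 * W + (r ^ 2 / 4 - x ^ 2) * W) ≠ 0 := by
        intro x hx h0
        have hk : Real.sqrt ((r ^ 2 / 4 - x ^ 2) * W) ^ 2 = (r ^ 2 / 4 - x ^ 2) * W :=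
          Real.sq_sqrt (mul_nonneg (sub_nonneg.2 hx) hW.le)
        refine hno (hcross t u (u + x) (Real.sqrt ((r ^ 2 / 4 - x ^ 2) * W)) (Real.sqrt_nonneg _)
          ?_ ?_)
        · rw [hk, hct, hu]; ring
        · rw [hk, add_sub_cancel_left]; exact h0
      by_cases hau : a u = 0
      -- A straight member through the centre hits the top of the half circle.
      · exact hmeet 0 (by rw [zero_pow two_ne_zero]; positivity) (by rw [hau]; ring)
      · set q : ℝ := c u / a u with hq
        have hq0 : q ≠ 0 := div_ne_zero (hc u) hau
        have hcu : c u = q * a u := by rw [hq]; field_simp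
        refine ih u hau ?_
        by_contra hlt
        rw [not_lt] at hlt
        have hqr : |r| ≤ 2 * |q| := by
          rw [pow_succ] at h
          nlinarith
        -- Subtracting the two circle equations gives `q x = -r² / 4`; this offset is admissible
        -- exactly when `|r| ≤ 2|q|`.
        refine hmeet (-(r ^ 2 / (4 * q))) ?_ ?_
        · have h1 : r ^ 2 ≤ 4 * q ^ 2 := by
            have := pow_le_pow_left₀ (abs_nonneg r) hqr 2
            rw [mul_pow, sq_abs, sq_abs] at this
            linarith
          rw [neg_sq, div_pow, div_le_iff₀ (by positivity)]
          nlinarith [sq_nonneg r]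
        · rw [hcu]
          field_simp
          ring
  by_contra ht
  obtain ⟨n, hn⟩ := pow_unbounded_of_one_lt (|c t / a t| / δ) one_lt_two
  refine key n t ht ?_
  rwa [div_lt_iff₀' hδ] at hn

theorem umbilicalRoute_eq_zero (hΦ : IsConformalInvolution Φ) (hp : p ∈ halfSpace m)
    (hw0 : w ≠ 0) (hw : height w = 0) (hγ : ∀ t : ℝ, γ t = Φ (p + t • w)) {h : ℝ → ℝ}
    (hh : IsUmbilicalRoute γ h) (t : ℝ) : h t = 0 := by
  obtain ⟨L, hL, F, -, hF⟩ := hh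
  choose Q hQb hQL using fun t => (hL t).1.exists_quadric
  choose Q' hb hQ hg using fun t => exists_grad_eq_smul hΦ hp hw0 hw hγ (Q t)
  have hg' : ∀ t, (Q' t).eval (p + t • w) = 0 ∧
      ∃ c : ℝ, c ≠ 0 ∧ (Q' t).grad (p + t • w) = c • w := fun t =>
    hg t t (hQL t ▸ (hL t).2.1) (hQL t ▸ (hL t).2.2.1)
  choose h0 c hc h1 using hg'
  have hW : 0 < ‖w‖ := norm_pos_iff.2 hw0
  have hp' : 0 < height p := hp
  have hmem : ∀ s k : ℝ, 0 ≤ k → p + s • w + k • eLast m ∈ halfSpace m := by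
    intro s k hk
    change 0 < height _
    rw [height_add, height_add, height_smul, height_smul, hw, height_eLast]
    linarith
  have hOn : ∀ t s k : ℝ, 0 ≤ k → (Φ (p + s • w + k • eLast m) ∈ L t ↔
      c t * (s - t) * ‖w‖ ^ 2 + (Q' t).a * ((s - t) ^ 2 * ‖w‖ ^ 2 + k ^ 2) = 0) := by
    intro t s k hk
    have h2 := Quadric.eval_line (s := s) (h0 t) (h1 t) (y := k • eLast m)
      (by rw [inner_smul_right, inner_eLast_right, hw, mul_zero])
    rw [norm_smul, norm_eLast, mul_one, Real.norm_eq_abs, sq_abs] at h2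
    rw [← h2, ← hQ t _ (hmem s k hk), hQL t]
    exact ⟨fun h => h.2, fun h => ⟨hΦ.mapsTo _ (hmem s k hk), h⟩⟩
  have ha : (Q' t).a = 0 := by
    refine eq_zero_of_noncrossing (a := fun t => (Q' t).a) (c := c) (W := ‖w‖ ^ 2)
      (δ := 2 * height p / ‖w‖) (by positivity) (by positivity) hc ?_ ?_ t
    -- The gradient `c • w` has length one and `|2 a height p| ≤ 1`, which together bound `|c / a|`
    -- from below.
    · intro t ht
      have h2 : c t ^ 2 * ‖w‖ ^ 2 = 1 := by
        have h3 := (Q' t).norm_grad (h0 t)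
        rw [h1 t, norm_smul, Real.norm_eq_abs] at h3
        rw [← sq_abs (c t), ← mul_pow, h3, one_pow]
      have h4 : (2 * (Q' t).a * height p) ^ 2 ≤ 1 := by
        have := hQb t
        rwa [← hb t, Quadric.height_b hw (h1 t), neg_sq] at this
      refine abs_le_of_sq_le_sq' ?_ (abs_nonneg _) |>.2
      rw [sq_abs, div_pow, div_pow, div_le_div_iff₀ (by positivity) (by positivity)]
      rw [h2]
      linarith
    · intro t u s k hk ht hu
      -- A common point makes the two leaves equal, so that `L t` contains `γ u`.
      have h2 := F.leaf_eq_of_mem (hF t ▸ (hOn t s k hk).2 ht) (hF u ▸ (hOn u s k hk).2 hu)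
      rw [← hF t, ← hF u] at h2
      have h3 := (hOn u u 0 le_rfl).2 (by ring)
      rw [← h2, hOn t u 0 le_rfl] at h3
      linarith
  have hb0 : height (Q t).b = 0 := by
    rw [← hb t, Quadric.height_b hw (h1 t), ha]; ring
  have h2 := (hL t).2.2.2
  rw [hQL t] at h2
  exact Quadric.meanCurvature_eq_zero hb0 h2

theorem exists_quadric_preimage_plane (hΦ : IsConformalInvolution Φ) {u : E m} (hu : ‖u‖ = 1)
    (hu0 : height u = 0) (b : ℝ) : ∃ R : Quadric m, height R.b = 0 ∧
      R.locus = {x ∈ halfSpace m | (inner ℝ u (Φ x) : ℝ) = b} ∧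
      ∀ x ∈ R.locus, ∃ (k : ℝ) (A : E m ≃ₗᵢ[ℝ] E m), 0 < k ∧
        HasFDerivAt Φ (k • (A : E m →L[ℝ] E m)) x ∧ u = A (R.grad x) := by
  obtain ⟨R, h1, h2⟩ := hΦ.exists_quadric (Quadric.plane u hu b)
  refine ⟨R, h1.trans hu0, ?_, fun x hx => ?_⟩
  · ext x
    refine and_congr_right fun hx => (h2 x hx).1.symm.trans ?_
    simp [Quadric.eval, Quadric.plane, ← sub_eq_add_neg, sub_eq_zero]
  · obtain ⟨k, A, hk, hA, hg⟩ := (h2 x hx.1).2 hx.2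
    refine ⟨k, A, hk, hA, ?_⟩
    rw [← hg]
    simp [Quadric.grad, Quadric.plane]

/-- The leaves are the preimages under `Φ` of the hyperplanes orthogonal to `w`. Conformality makes
them orthogonal to `γ`, and the invariance of `height b` makes them totally geodesic. -/
theorem isUmbilicalRoute_zero (hΦ : IsConformalInvolution Φ) (hp : p ∈ halfSpace m)
    (hw0 : w ≠ 0) (hw : height w = 0) (hγ : ∀ t : ℝ, γ t = Φ (p + t • w)) {h : ℝ → ℝ}
    (hh : ∀ t, h t = 0) : IsUmbilicalRoute γ h := by
  have hW : ‖w‖ ≠ 0 := norm_ne_zero_iff.2 hw0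
  set u : E m := ‖w‖⁻¹ • w with hu
  have hu1 : ‖u‖ = 1 := by rw [hu, norm_smul, norm_inv, norm_norm, inv_mul_cancel₀ hW]
  have hu0 : height u = 0 := by rw [hu, height_smul, hw, mul_zero]
  have hwu : w = ‖w‖ • u := by rw [hu, smul_smul, mul_inv_cancel₀ hW, one_smul]
  obtain ⟨C, hC⟩ := exists_coordinates (u := u) (norm_ne_zero_iff.1 (by rw [hu1]; exact one_ne_zero))
  have hmem : ∀ t, γ t ∈ halfSpace m := fun t =>
    hγ t ▸ hΦ.mapsTo _ (add_smul_mem_halfSpace hp hw t)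
  have hinv : ∀ t, Φ (γ t) = p + t • w := fun t => by
    rw [hγ t, hΦ.invol _ (add_smul_mem_halfSpace hp hw t)]
  refine ⟨fun t => (verticalFoliation hΦ C).leaf (γ t), fun t => ?_, verticalFoliation hΦ C, ?_,
    fun t => rfl⟩
  · obtain ⟨R, hR0, hRL, hR⟩ := exists_quadric_preimage_plane hΦ hu1 hu0 (inner ℝ u (Φ (γ t)))
    have hL : (verticalFoliation hΦ C).leaf (γ t) = R.locus := by
      rw [leaf_verticalFoliation hΦ hC hu0 (hmem t), hRL]
    have hγR : γ t ∈ R.locus := by rw [hRL]; exact ⟨hmem t, rfl⟩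
    obtain ⟨k, A, hk, hA, hg⟩ := hR _ hγR
    have hdγ : HasDerivAt γ (deriv γ t) t := by
      have h1 : DifferentiableAt ℝ Φ (p + t • w) := (hΦ.contDiffOn.contDiffAt
        (isOpen_halfSpace.mem_nhds (add_smul_mem_halfSpace hp hw t))).differentiableAt (by simp)
      have h2 := (h1.hasFDerivAt.comp_hasDerivAt t (hasDerivAt_line p w t)).differentiableAt
      have h3 : γ = Φ ∘ fun t : ℝ => p + t • w := funext hγ
      rw [← h3] at h2
      exact h2.hasDerivAt
    have hd : w = k • A (deriv γ t) := by
      have h1 := hA.comp_hasDerivAt t hdγ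
      have h2 : Φ ∘ γ = fun t : ℝ => p + t • w := funext hinv
      rw [h2] at h1
      exact (hasDerivAt_line p w t).unique h1
    have hγ' : deriv γ t = (k⁻¹ * ‖w‖) • R.grad (γ t) := by
      apply A.injective
      rw [map_smul, ← hg, mul_smul, ← hwu, hd, smul_smul, inv_mul_cancel₀ hk.ne', one_smul]
    beta_reduce
    rw [hL, hh t]
    refine ⟨Quadric.isGenHypersphere hR0, hγR, Quadric.isNormalTo_of_eq_smul hγR hγ', ?_⟩
    refine Quadric.hasMeanCurvature_zero hγR hR0 (k := -(k⁻¹ * ‖w‖))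
      (neg_ne_zero.2 (mul_ne_zero (inv_ne_zero hk.ne') hW)) ?_
    rw [hγ', neg_smul]
  · rintro _ rfl x hx
    obtain ⟨R, hR0, hRL, -⟩ := exists_quadric_preimage_plane hΦ hu1 hu0 (inner ℝ u (Φ x))
    rw [plaque_verticalChart hΦ hC hu0, ← hRL]
    have hxR : x ∈ R.locus := by rw [hRL]; exact ⟨hx, rfl⟩
    refine ⟨_, _, R.localDef hxR, 0, ?_⟩
    rw [Quadric.shapeOperator_eq_zero (R.localDef hxR) hR0, zero_smul]

end NormalForm

end HypUmb

end

theorem mainTheorem5 {m : ℕ} (hm : 1 ≤ m) {γ : ℝ → HypUmb.E m} (hγ : HypUmb.IsHorocycle γ) :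
    -- the only umbilical route along `γ` is the zero function
    (∀ h : ℝ → ℝ, HypUmb.IsUmbilicalRoute γ h ↔ ∀ t : ℝ, h t = 0) ∧
    -- generalized hyperspheres orthogonal to `γ` are totally geodesic
    (∀ L : Set (HypUmb.E m), HypUmb.IsGenHypersphere L → HypUmb.MeetsOnceOrthogonally γ L →
      HypUmb.IsTotallyGeodesic L) ∧
    -- in the half-space model with `γ` a horizontal line they are vertical hyperplanes,
    (HypUmb.IsHorizontalLine γ →
      ∀ L : Set (HypUmb.E m), HypUmb.IsGenHypersphere L → HypUmb.MeetsOnceOrthogonally γ L →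
        HypUmb.IsVerticalHyperplane L) ∧
    -- and an isometry of the model brings `γ` to this position
    (∃ Φ : HypUmb.E m → HypUmb.E m, HypUmb.IsHypIsometry Φ ∧
      HypUmb.IsHorizontalLine (fun t => Φ (γ t)) ∧
      ∀ L : Set (HypUmb.E m), HypUmb.IsGenHypersphere L → HypUmb.MeetsOnceOrthogonally γ L →
        HypUmb.IsVerticalHyperplane (Φ '' L)) := by
  obtain ⟨Φ, p, w, hΦ, hp, hw0, hw, hγ'⟩ := hγ.exists_normalForm
  refine ⟨fun h => ⟨HypUmb.umbilicalRoute_eq_zero hΦ hp hw0 hw hγ',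
    HypUmb.isUmbilicalRoute_zero hΦ hp hw0 hw hγ'⟩,
    fun L hL h => (HypUmb.orthogonal_genHypersphere hΦ hp hw0 hw hγ' hL h).1, ?_,
    Φ, hΦ.isHypIsometry, ⟨p, w, hw0, hw, fun t => ?_⟩,
    fun L hL h => (HypUmb.orthogonal_genHypersphere hΦ hp hw0 hw hγ' hL h).2⟩
  -- Here `γ` is itself the line, so the identity serves as the isometry.
  · rintro ⟨p', w', hw0', hw', hline⟩ L hL h
    have hp' : p' ∈ HypUmb.halfSpace m := by
      have h0 := hline 0
      rw [hγ' 0, zero_smul, zero_smul, add_zero, add_zero] at h0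
      exact h0 ▸ hΦ.mapsTo p hp
    have := (HypUmb.orthogonal_genHypersphere HypUmb.isConformalInvolution_id hp' hw0' hw' hline
      hL h).2
    rwa [Set.image_id] at this
  · beta_reduce
    rw [hγ' t, hΦ.invol _ (HypUmb.add_smul_mem_halfSpace hp hw t)]
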